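/- **Theorem (Arbitrary approximate multiplication).** Let $\sigma_x,\sigma_z$ be the Pauli matrices. A unitary is *embeddable* if it equals $e^{i\theta\sigma_x}$ for some $\theta\in[0,\pi]$, and *twisted embeddable* if it equals $e^{i\varphi\sigma_z/2}e^{i\theta\sigma_x}e^{-i\varphi\sigma_z/2}$ for some $\theta\in[0,\pi]$, $\varphi\in[-\pi,\pi]$. An *ancilla-free $(a,1)$ gadget* is a single-qubit circuit, i.e. a finite product of factors each of which is either a query to one of $a$ black-box single-qubit oracles $U_0,\dots,U_{a-1}$ or a fixed single-qubit unitary, whose output $U'=\mathfrak G[U_0,\dots,U_{a-1}]$ is twisted embeddable whenever all the $U_j$ are embeddable. Its *cost* is the number of its queries and its *depth* the number of its factors. For $\varepsilon>0$ it *$\varepsilon$-approximately achieves* a function $f$ on $D\subseteq[-1,1]^a$ if, for all $x\in D$, with $U_j=e^{i\arccos(x_j)\sigma_x}$ one has $|\langle 0|U'|0\rangle-f(x)|\le\varepsilon$. The *product circuit* is $$e^{-i\frac{\pi}{4}\sigma_z}\,U_0\,e^{i\frac{\pi}{4}\sigma_z}\,U_1\,e^{-i\frac{\pi}{4}\sigma_z}\,U_0\,e^{i\frac{\pi}{4}\sigma_z},$$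 which achieves $T_2(x_0)\,x_1=(2x_0^2-1)x_1$. There is a constant $C>0$ such that for all $0<\delta\le 1$ and $0<\varepsilon\le 1/2$ there is an ancilla-free $(2,1)$ gadget $\mathfrak G$ whose cost and depth are both at most $$C\,\delta^{-1}\log\!\left(\varepsilon^{-2}\delta^{-1/4}\right)$$ and which $\varepsilon$-approximately achieves $f(x_0,x_1)=x_0x_1$ for all $x_0\in[-1+\delta,1-\delta]$ and $x_1\in[-1,1]$. Moreover, $\mathfrak G$ can be taken to be the composition obtained by substituting into the product circuit, for both queries to $U_0$, an ancilla-free $(1,1)$ gadget (with oracle $U_0$) that $\varepsilon$-approximately achieves the right-inverse $T_2^{-1}(x)=\sqrt{(1+x)/2}$ of $T_2$ for all $x\in[-1+\delta,1-\delta]$. -/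

import Mathlib

namespace QGadget

/-- Operators on one qubit, in the computational basis. -/
abbrev Op := Matrix (Fin 2) (Fin 2) ℂ

/-- The Pauli matrix `σ_x`. -/
def pauliX : Op := !![0, 1; 1, 0]

/-- The Pauli matrix `σ_z`. -/
def pauliZ : Op := !![1, 0; 0, -1]

/-- `e^{iθσ_x}`, entrywise; see `rotX_eq_exp`. -/
noncomputable def rotX (θ : ℝ) : Op :=
  !![(Real.cos θ : ℂ), Complex.I * (Real.sin θ : ℂ);
     Complex.I * (Real.sin θ : ℂ), (Real.cos θ : ℂ)]

/-- `e^{iφσ_z}`, entrywise; see `rotZ_eq_exp`. -/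
noncomputable def rotZ (φ : ℝ) : Op :=
  !![Complex.exp (Complex.I * (φ : ℂ)), 0; 0, Complex.exp (-(Complex.I * (φ : ℂ)))]

theorem rotZ_eq_exp (φ : ℝ) :
    rotZ φ = NormedSpace.exp ((Complex.I * (φ : ℂ)) • pauliZ) := by
  have h : (Complex.I * (φ : ℂ)) • pauliZ
      = Matrix.diagonal ![Complex.I * (φ : ℂ), -(Complex.I * (φ : ℂ))] := by
    ext i j
    fin_cases i <;> fin_cases j <;> simp [pauliZ]
  rw [h, Matrix.exp_diagonal]
  ext i j
  fin_cases i <;> fin_cases j <;> simp [rotZ, Pi.coe_exp, Complex.exp_eq_exp_ℂ]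

theorem rotX_eq_exp (θ : ℝ) :
    rotX θ = NormedSpace.exp ((Complex.I * (θ : ℂ)) • pauliX) := by
  have hinv : (!![1, 1; 1, -1] : Op)⁻¹ = !![1 / 2, 1 / 2; 1 / 2, -(1 / 2)] := by
    apply Matrix.inv_eq_right_inv
    ext i j
    fin_cases i <;> fin_cases j <;> norm_num [Matrix.mul_apply, Fin.sum_univ_two]
  have hu : IsUnit (!![1, 1; 1, -1] : Op) := by
    rw [Matrix.isUnit_iff_isUnit_det, Matrix.det_fin_two_of]
    norm_num
  have h : (Complex.I * (θ : ℂ)) • pauliX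
      = !![1, 1; 1, -1] * ((Complex.I * (θ : ℂ)) • pauliZ) * (!![1, 1; 1, -1] : Op)⁻¹ := by
    rw [hinv]
    ext i j
    fin_cases i <;> fin_cases j <;>
      simp [pauliX, pauliZ, Matrix.mul_apply, Fin.sum_univ_two] <;> ring
  have e1 : Complex.exp (Complex.I * (θ : ℂ)) = Complex.cos θ + Complex.sin θ * Complex.I := by
    rw [mul_comm, Complex.exp_mul_I]
  have e2 : Complex.exp (-(Complex.I * (θ : ℂ)))
      = Complex.cos θ - Complex.sin θ * Complex.I := by
    rw [mul_comm, ← neg_mul, Complex.exp_mul_I, Complex.cos_neg, Complex.sin_neg]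
    ring
  rw [h, Matrix.exp_conj _ _ hu, ← rotZ_eq_exp, hinv]
  ext i j
  fin_cases i <;> fin_cases j <;>
    simp [rotX, rotZ, Matrix.mul_apply, Fin.sum_univ_two, e1, e2] <;> ring

theorem rotZ_mem_unitaryGroup (φ : ℝ) : rotZ φ ∈ Matrix.unitaryGroup (Fin 2) ℂ := by
  rw [Matrix.mem_unitaryGroup_iff]
  ext i j
  fin_cases i <;> fin_cases j <;>
    simp [rotZ, Matrix.mul_apply, Fin.sum_univ_two, Matrix.star_apply, ← Complex.exp_conj,
      ← Complex.exp_add]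

/-- `e^{iφσ_z}` as an element of the unitary group. -/
noncomputable def zGate (φ : ℝ) : Matrix.unitaryGroup (Fin 2) ℂ :=
  ⟨rotZ φ, rotZ_mem_unitaryGroup φ⟩

/-- `U = e^{iθσ_x}` for some `θ ∈ [0, π]`. -/
def IsEmbeddable (U : Op) : Prop :=
  ∃ θ ∈ Set.Icc (0 : ℝ) Real.pi, U = rotX θ

/-- `U = e^{iφσ_z/2} e^{iθσ_x} e^{-iφσ_z/2}` for some `θ ∈ [0, π]` and `φ ∈ [-π, π]`. -/
def IsTwistedEmbeddable (U : Op) : Prop :=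
  ∃ θ ∈ Set.Icc (0 : ℝ) Real.pi, ∃ φ ∈ Set.Icc (-Real.pi) Real.pi,
    U = rotZ (φ / 2) * rotX θ * rotZ (-(φ / 2))

/-- One layer of a single-qubit circuit with `a` black-box oracles: a query to one oracle, or a
fixed unitary that does not depend on the oracles. -/
inductive Gate (a : ℕ) : Type
  | query (j : Fin a) : Gate a
  | fixed (W : Matrix.unitaryGroup (Fin 2) ℂ) : Gate a

/-- The operator that a gate applies when the oracles are `U`. -/
def Gate.eval {a : ℕ} (U : Fin a → Op) : Gate a → Op
  | .query j => U j
  | .fixed W => (W : Op)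

/-- Whether a gate is a query to the oracle `j`. -/
def Gate.isQuery {a : ℕ} (j : Fin a) : Gate a → Bool
  | .query k => decide (k = j)
  | .fixed _ => false

/-- A single-qubit (hence ancilla-free) circuit with `a` oracles: the list of its layers, in the
order in which they are multiplied, from left to right. -/
abbrev Circuit (a : ℕ) := List (Gate a)

namespace Circuit

/-- The unitary produced by the circuit from the oracles `U`. -/
def eval {a : ℕ} (c : Circuit a) (U : Fin a → Op) : Op :=
  (c.map (Gate.eval U)).prod

/-- The number of queries to the oracle `j`. -/
def queries {a : ℕ} (c : Circuit a) (j : Fin a) : ℕ :=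
  c.countP (Gate.isQuery j)

/-- The number of layers, queries and fixed gates together. -/
def depth {a : ℕ} (c : Circuit a) : ℕ := c.length

/-- Substitution of circuits for the oracles of a circuit. -/
def subst {a b : ℕ} (c : Circuit b) (f : Fin b → Circuit a) : Circuit a :=
  c.flatMap fun g =>
    match g with
    | .query j => f j
    | .fixed W => [.fixed W]

/-- The circuit `e^{iφ₀σ_z} ∏ₖ U_{sₖ} e^{iφₖσ_z}` of the M-QSP protocol with first phase `φ₀` and
list `[(s₁, φ₁), …, (sₙ, φₙ)]` of oracle labels and remaining phases. -/
noncomputable def mqsp {t : ℕ} (φ₀ : ℝ) (l : List (Fin t × ℝ)) : Circuit t :=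
  Gate.fixed (zGate φ₀) :: l.flatMap fun p => [Gate.query p.1, Gate.fixed (zGate p.2)]

end Circuit

/-- An ancilla-free `(a, b)` gadget: a superoperator, given by one single-qubit circuit for each of
its `b` output legs, that takes all embeddable oracles to twisted embeddable unitaries. -/
structure Gadget (a b : ℕ) where
  circuit : Fin b → Circuit a
  twisted : ∀ U : Fin a → Op, (∀ j, IsEmbeddable (U j)) →
    ∀ k, IsTwistedEmbeddable ((circuit k).eval U)

namespace Gadget

/-- The function achieved by the output leg `k`: the entry `⟨0|U'ₖ|0⟩` of the output unitary on the
oracles `e^{i arccos(xⱼ) σ_x}`. -/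
noncomputable def achieved {a b : ℕ} (G : Gadget a b) (k : Fin b) (x : Fin a → ℝ) : ℂ :=
  (G.circuit k).eval (fun j => rotX (Real.arccos (x j))) 0 0

/-- `G` achieves the functions `F k` on the domain `D` up to the error `ε`. -/
def ApproxAchieves {a b : ℕ} (G : Gadget a b) (ε : ℝ) (F : Fin b → (Fin a → ℝ) → ℝ)
    (D : Set (Fin a → ℝ)) : Prop :=
  ∀ x ∈ D, ∀ k, ‖G.achieved k x - (F k x : ℂ)‖ ≤ ε

/-- The number of queries to the input leg `j` made for the output leg `k`
(an entry of the cost matrix). -/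
def costMatrix {a b : ℕ} (G : Gadget a b) : Matrix (Fin a) (Fin b) ℕ :=
  Matrix.of fun j k => (G.circuit k).queries j

/-- The total number of black-box queries to the input oracles. -/
def cost {a b : ℕ} (G : Gadget a b) : ℕ := ∑ k, ∑ j, G.costMatrix j k

/-- The largest depth of the circuits of the output legs. -/
def depth {a b : ℕ} (G : Gadget a b) : ℕ := Finset.univ.sup fun k => (G.circuit k).depth

end Gadget

/-- The two-variable M-QSP protocol with phases `(-π/4, π/4, -π/4, π/4)` and oracle labels
`(0, 1, 0)`, which achieves `T₂(x₀) x₁`. -/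
noncomputable def productCircuit : Circuit 2 :=
  Circuit.mqsp (-(Real.pi / 4)) [(0, Real.pi / 4), (1, -(Real.pi / 4)), (0, Real.pi / 4)]

/-- The partial composition that links the output of `c` to the input leg `0` of the product
circuit. The input of `c` becomes the new leg `0`, and leg `1` stays. -/
noncomputable def linkProduct (c : Circuit 1) : Circuit 2 :=
  productCircuit.subst ![c.subst fun _ => [.query 0], [.query 1]]

end QGadget

/-! With x₀ = cos θ, the right-inverse of T₂ is cos(θ/2), so the task is to build an approximate
square root of e^{iθσ_x} that is twisted embeddable for every θ, not only where the approximation is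
good. A palindrome provides this. If a circuit evaluates to an SU(2) matrix with first row (α, β),
then following it by its image under A ↦ σ_z Aᴴ σ_z gives diagonal |α|² − |β|², which is always
real, and off-diagonal entry 2αβ. It therefore suffices to approximate the fourth root e^{iθσ_x/4}
on one eigenvector of σ_x.

Put t = −cos θ, so that arcsin t = θ − π/2 and e^{iθ/4} = e^{iπ/8} e^{i arcsin(t)/4}. The functions
cos(arcsin t/4) and sin(arcsin t/4)/√(1−t²) have power series whose signs are known, so truncations
can be arranged never to leave the unit disc (`quarterCos_sq_add_le_one`), while for |t| ≤ 1−δ the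
error decays like (1−δ)^{2N}/δ. This is where degree δ⁻¹ log(·) comes from.

In w = e^{2iθ} the truncation is a polynomial of modulus at most 1 on the circle. After a slight
shrinking, Fejér–Riesz (`exists_eval_eq_norm_sq_mul_pow`) completes it to a unit vector of
polynomials, and stripping one layer at a time (`exists_circuit_of_norm_sq_add_norm_sq_eq_one`)
turns that vector into a circuit of linear length.

Substituted into the product circuit, a palindrome with diagonal r and off-diagonal β yields
(2r²−1)x₁ + 2r√(1−x₁²) Re β (`eval_linkProduct`). Exactly, β would be purely imaginary. An error η
in the fourth root bounds Re β only by order √η (`palindrome_error`), so η is taken of order ε². -/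

namespace QGadget

/-! ### Power series of cos(arcsin t / 4) and sin(arcsin t / 4) -/

open Finset

/-- The coefficients of `1 - cos (arcsin t / 4) = ∑ dⱼ t ^ (2 * j + 2)`. -/
noncomputable def quarterCoeff : ℕ → ℝ
  | 0 => 1 / 32
  | j + 1 => (4 * (j + 1 : ℝ) ^ 2 - 1 / 16) / ((2 * j + 3) * (2 * j + 4)) * quarterCoeff j

/-- This is the recurrence that (1−t²)f'' − tf' + f/16 = 0, the equation of f(t) = cos(arcsin t/4),
imposes on the even coefficients. -/
theorem quarterCoeff_succ (j : ℕ) :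
    (2 * j + 3 : ℝ) * (2 * j + 4) * quarterCoeff (j + 1)
      = (4 * (j + 1 : ℝ) ^ 2 - 1 / 16) * quarterCoeff j := by
  have h : (2 * j + 3 : ℝ) * (2 * j + 4) ≠ 0 := by positivity
  rw [quarterCoeff]
  field_simp

theorem quarterCoeff_nonneg (j : ℕ) : 0 ≤ quarterCoeff j := by
  induction j with
  | zero => norm_num [quarterCoeff]
  | succ j ih =>
    have hj : (0 : ℝ) ≤ j := j.cast_nonneg
    have h : (0 : ℝ) ≤ 4 * (j + 1 : ℝ) ^ 2 - 1 / 16 := by nlinarith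
    rw [quarterCoeff]
    positivity

/-- The weighted coefficients decrease, by at least a third of the coefficient. -/
theorem quarterCoeff_le_three_mul_sub (j : ℕ) :
    quarterCoeff j ≤ 3 * ((j + 1) * quarterCoeff j - (j + 2) * quarterCoeff (j + 1)) := by
  have hj : (0 : ℝ) ≤ j := j.cast_nonneg
  have h := quarterCoeff_succ j
  have h0 := quarterCoeff_nonneg j
  have e : (2 * j + 3 : ℝ) * ((j + 1) * quarterCoeff j - (j + 2) * quarterCoeff (j + 1))
      = (j + 1 + 1 / 32) * quarterCoeff j := by linear_combination (-1 / 2) * h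
  have h3 : (0 : ℝ) < 2 * j + 3 := by positivity
  refine le_of_mul_le_mul_left ?_ h3
  nlinarith

theorem mul_quarterCoeff_le (j : ℕ) : (j + 1) * quarterCoeff j ≤ 1 / 32 := by
  induction j with
  | zero => norm_num [quarterCoeff]
  | succ j ih =>
    have h1 := quarterCoeff_le_three_mul_sub j
    have h2 := quarterCoeff_nonneg j
    push_cast
    linarith

theorem quarterCoeff_le (j : ℕ) : quarterCoeff j ≤ 1 / 32 := by
  have h1 := mul_quarterCoeff_le j
  have h2 := quarterCoeff_nonneg j
  have hj : (0 : ℝ) ≤ j := j.cast_nonneg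
  nlinarith

theorem sum_range_quarterCoeff_le (n : ℕ) : ∑ j ∈ range n, quarterCoeff j ≤ 3 / 32 := by
  -- The subtracted term makes the induction telescope; at n = 0 the bound is an equality.
  have h : ∑ j ∈ range n, quarterCoeff j ≤ 3 / 32 - 3 * ((n + 1) * quarterCoeff n) := by
    induction n with
    | zero => norm_num [quarterCoeff]
    | succ n ih =>
      have h1 := quarterCoeff_le_three_mul_sub n
      rw [sum_range_succ]
      push_cast
      linarith
  have := quarterCoeff_nonneg n
  have : 0 ≤ 3 * ((n + 1) * quarterCoeff n) := by positivity
  linarith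

theorem summable_quarterCoeff : Summable quarterCoeff :=
  summable_of_sum_range_le quarterCoeff_nonneg sum_range_quarterCoeff_le

/-- Power series with coefficients of linear growth can be differentiated term by term. -/
theorem hasDerivAt_tsum_mul_pow {c : ℕ → ℝ} (hc : ∀ k, |c k| ≤ k + 1) {u : ℝ} (hu : |u| < 1) :
    HasDerivAt (fun v => ∑' k, c k * v ^ k) (∑' k, (k + 1) * c (k + 1) * u ^ k) u := by
  obtain ⟨r, hur, hr1⟩ := exists_between hu
  have hr0 : 0 ≤ r := (abs_nonneg u).trans hur.le
  have hrn : ‖r‖ < 1 := by rwa [Real.norm_of_nonneg hr0]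
  have hs : Summable fun k : ℕ => (k : ℝ) * ((k + 1) * r ^ (k - 1)) := by
    rw [← summable_nat_add_iff 1]
    have h1 := summable_pow_mul_geometric_of_norm_lt_one 1 hrn
    have h2 := summable_pow_mul_geometric_of_norm_lt_one 2 hrn
    have h0 := summable_geometric_of_norm_lt_one hrn
    refine ((h2.add (h1.mul_left 3)).add (h0.mul_left 2)).congr fun k => ?_
    push_cast
    ring
  have key := hasDerivAt_tsum_of_isPreconnected (t := Metric.ball (0 : ℝ) r) (y₀ := 0) (y := u)
    (g := fun k v => c k * v ^ k) (g' := fun k v => c k * (k * v ^ (k - 1))) hs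
    Metric.isOpen_ball (convex_ball _ _).isPreconnected
    (fun k v _ => (hasDerivAt_pow k v).const_mul _) ?_ ?_ ?_ ?_
  · refine key.congr_deriv ?_
    have hs' : Summable fun k : ℕ => c k * (k * u ^ (k - 1)) := by
      refine hs.of_norm_bounded fun k => ?_
      rw [Real.norm_eq_abs, abs_mul, abs_mul, abs_pow, Nat.abs_cast, mul_left_comm]
      gcongr
      exact hc k
    rw [hs'.tsum_eq_zero_add]
    simp only [Nat.cast_zero, zero_mul, mul_zero, zero_add]
    refine tsum_congr fun k => ?_
    push_cast
    ring
  · intro k v hv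
    rw [mem_ball_zero_iff, Real.norm_eq_abs] at hv
    rw [Real.norm_eq_abs, abs_mul, abs_mul, abs_pow, Nat.abs_cast, mul_left_comm]
    gcongr
    exact hc k
  · rw [mem_ball_zero_iff, norm_zero]
    exact (abs_nonneg u).trans_lt hur
  · refine (hasSum_single 0 fun k hk => ?_).summable
    simp [hk]
  · rwa [mem_ball_zero_iff, Real.norm_eq_abs]

theorem summable_mul_pow {c : ℕ → ℝ} (hc : ∀ k, |c k| ≤ k + 1) {u : ℝ} (hu : |u| < 1) :
    Summable fun k => c k * u ^ k := by
  have hun : ‖|u|‖ < 1 := by rwa [Real.norm_eq_abs, abs_abs]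
  have h1 := summable_pow_mul_geometric_of_norm_lt_one 1 hun
  have h0 := summable_geometric_of_norm_lt_one hun
  refine (h1.add h0).of_norm_bounded fun k => ?_
  rw [Real.norm_eq_abs, abs_mul, abs_pow, pow_one, ← add_one_mul]
  gcongr
  exact hc k

/-- The series `∑ dⱼ u ^ j`. -/
noncomputable def quarterSeries (u : ℝ) : ℝ := ∑' j, quarterCoeff j * u ^ j

/-- The series `∑ (j + 1) dⱼ u ^ j`, the derivative of `u * quarterSeries u`. -/
noncomputable def quarterDeriv (u : ℝ) : ℝ := ∑' j : ℕ, ((j + 1) * quarterCoeff j) * u ^ j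

theorem abs_quarterCoeff_le (j : ℕ) : |quarterCoeff j| ≤ j + 1 := by
  have hj : (0 : ℝ) ≤ j := j.cast_nonneg
  rw [abs_of_nonneg (quarterCoeff_nonneg j)]
  linarith [quarterCoeff_le j]

theorem abs_mul_quarterCoeff_le (j : ℕ) : |(j + 1) * quarterCoeff j| ≤ j + 1 := by
  have hj : (0 : ℝ) ≤ j := j.cast_nonneg
  have := quarterCoeff_nonneg j
  rw [abs_of_nonneg (by positivity)]
  linarith [mul_quarterCoeff_le j]

theorem hasSum_quarterSeries {u : ℝ} (hu : |u| < 1) :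
    HasSum (fun j => quarterCoeff j * u ^ j) (quarterSeries u) :=
  (summable_mul_pow abs_quarterCoeff_le hu).hasSum

theorem hasSum_quarterDeriv {u : ℝ} (hu : |u| < 1) :
    HasSum (fun j : ℕ => ((j + 1) * quarterCoeff j) * u ^ j) (quarterDeriv u) :=
  (summable_mul_pow abs_mul_quarterCoeff_le hu).hasSum

theorem hasDerivAt_mul_quarterSeries {u : ℝ} (hu : |u| < 1) :
    HasDerivAt (fun v => v * quarterSeries v) (quarterDeriv u) u := by
  have h := (hasDerivAt_id u).mul (hasDerivAt_tsum_mul_pow abs_quarterCoeff_le hu)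
  refine h.congr_deriv ?_
  have hs : Summable fun k : ℕ => (k + 1) * quarterCoeff (k + 1) * u ^ k := by
    refine summable_mul_pow (fun k => ?_) hu
    have := quarterCoeff_nonneg (k + 1)
    have h1 := mul_quarterCoeff_le (k + 1)
    push_cast at h1
    have hk : (0 : ℝ) ≤ k := k.cast_nonneg
    rw [abs_of_nonneg (by positivity)]
    linarith
  have h0 := hasSum_quarterSeries hu
  have h1 := (hs.hasSum.mul_left u)
  have h2 : HasSum (fun k : ℕ => k * quarterCoeff k * u ^ k)
      (u * ∑' k : ℕ, (k + 1) * quarterCoeff (k + 1) * u ^ k) := by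
    rw [← hasSum_nat_add_iff' 1]
    simp only [range_one, sum_singleton, Nat.cast_zero, zero_mul, sub_zero]
    refine h1.congr_fun fun k => ?_
    push_cast
    ring
  have h3 := (h0.add h2).congr_fun (g := fun j : ℕ => ((j + 1) * quarterCoeff j) * u ^ j)
    fun k => by ring
  rw [one_mul, id, (hasSum_quarterDeriv hu).unique h3]
  rfl

/-- The differential equation in the variable u = t². Comparing coefficients of u^(k+1) gives
`quarterCoeff_succ`; the constant term is 2 · 1/32 = 1/16. -/
theorem hasDerivAt_quarterDeriv {u : ℝ} (hu : |u| < 1) :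
    ∃ e, HasDerivAt quarterDeriv e u ∧
      4 * u * (1 - u) * e + 2 * (1 - 2 * u) * quarterDeriv u
        = 1 / 16 * (1 - u * quarterSeries u) := by
  refine ⟨_, hasDerivAt_tsum_mul_pow abs_mul_quarterCoeff_le hu, ?_⟩
  set s : ℕ → ℝ := fun k =>
    (k + 1) * (((k + 1 : ℕ) + 1) * quarterCoeff (k + 1)) * u ^ k with hs
  have hsum : Summable s := by
    refine summable_mul_pow (fun k => ?_) hu
    have := quarterCoeff_nonneg (k + 1)
    have h1 := mul_quarterCoeff_le (k + 1)
    rw [abs_of_nonneg (by positivity)]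
    have hk : (0 : ℝ) ≤ k := k.cast_nonneg
    nlinarith
  have hE := hsum.hasSum
  have hD := hasSum_quarterDeriv hu
  have hS := hasSum_quarterSeries hu
  have hEu : HasSum (fun k : ℕ => k * ((k + 1) * quarterCoeff k) * u ^ k) (u * ∑' k, s k) := by
    rw [← hasSum_nat_add_iff' 1]
    simp only [range_one, sum_singleton, Nat.cast_zero, zero_mul, sub_zero]
    refine (hE.mul_left u).congr_fun fun k => ?_
    simp only [hs]
    push_cast
    ring
  have hD' : HasSum (fun k : ℕ => ((k + 1 : ℕ) + 1) * quarterCoeff (k + 1) * u ^ (k + 1))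
      (quarterDeriv u - 1 / 32) := by
    have := (hasSum_nat_add_iff' 1).2 hD
    simpa [quarterCoeff] using this
  have tot := (((((hE.mul_left u).mul_left 4).sub ((hEu.mul_left u).mul_left 4)).add
    (hD'.mul_left 2)).sub ((hD.mul_left u).mul_left 4)).add ((hS.mul_left u).mul_left (1 / 16))
  have z := tot.unique (hasSum_zero.congr_fun fun k => ?_)
  · linear_combination z
  · have := quarterCoeff_succ k
    simp only [hs]
    push_cast
    linear_combination (u ^ (k + 1)) * this

theorem abs_sin_sq_lt_one {ψ : ℝ} (h : Real.cos ψ ≠ 0) : |Real.sin ψ ^ 2| < 1 := by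
  rw [abs_of_nonneg (sq_nonneg _)]
  have := Real.sin_sq_add_cos_sq ψ
  have : 0 < Real.cos ψ ^ 2 := by positivity
  linarith

/-- The two series evaluated on the circle, for `ψ ∈ (-π/2, π/2)`. -/
theorem quarterSeries_sin_sq {ψ : ℝ} (hψ : ψ ∈ Set.Ioo (-(Real.pi / 2)) (Real.pi / 2)) :
    1 - Real.sin ψ ^ 2 * quarterSeries (Real.sin ψ ^ 2) = Real.cos (ψ / 4) ∧
      8 * Real.sin ψ * Real.cos ψ * quarterDeriv (Real.sin ψ ^ 2) = Real.sin (ψ / 4) := by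
  set I := Set.Ioo (-(Real.pi / 2)) (Real.pi / 2) with hI
  have hcos : ∀ x ∈ I, |Real.sin x ^ 2| < 1 := fun x hx =>
    abs_sin_sq_lt_one (Real.cos_pos_of_mem_Ioo hx).ne'
  -- A and B are the defects of the two identities. They satisfy A' = −B/4 and B' = A/4, so A² + B²
  -- is constant, and it vanishes at 0.
  let A : ℝ → ℝ := fun x =>
    1 - Real.sin x ^ 2 * quarterSeries (Real.sin x ^ 2) - Real.cos (x / 4)
  let B : ℝ → ℝ := fun x =>
    8 * Real.sin x * Real.cos x * quarterDeriv (Real.sin x ^ 2) - Real.sin (x / 4)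
  have hsq : ∀ x, HasDerivAt (fun x => Real.sin x ^ 2) (2 * Real.sin x * Real.cos x) x := by
    intro x
    refine ((Real.hasDerivAt_sin x).pow 2).congr_deriv ?_
    simp
  have h4 : ∀ x : ℝ, HasDerivAt (fun x : ℝ => x / 4) (1 / 4) x := fun x =>
    (hasDerivAt_id x).div_const 4
  have hA : ∀ x ∈ I, HasDerivAt A (-(1 / 4) * B x) x := by
    intro x hx
    have h1 := (hasDerivAt_mul_quarterSeries (hcos x hx)).comp x (hsq x)
    have h2 := (Real.hasDerivAt_cos (x / 4)).comp x (h4 x)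
    refine ((h1.const_sub 1).sub h2).congr_deriv ?_
    simp only [B]
    ring
  have hB : ∀ x ∈ I, HasDerivAt B (1 / 4 * A x) x := by
    intro x hx
    obtain ⟨e, he, hode⟩ := hasDerivAt_quarterDeriv (hcos x hx)
    have h1 := he.comp x (hsq x)
    have h2 := (Real.hasDerivAt_sin (x / 4)).comp x (h4 x)
    have h3 := ((Real.hasDerivAt_sin x).const_mul 8).mul (Real.hasDerivAt_cos x)
    refine ((h3.mul h1).sub h2).congr_deriv ?_
    have hc : Real.cos x ^ 2 = 1 - Real.sin x ^ 2 := by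
      rw [← Real.sin_sq_add_cos_sq x]; ring
    simp only [A, Function.comp, Pi.mul_apply]
    linear_combination 4 * hode
      + (8 * quarterDeriv (Real.sin x ^ 2) + 16 * Real.sin x ^ 2 * e) * hc
  have hE : ∀ x ∈ I, HasDerivAt (fun x => A x ^ 2 + B x ^ 2) 0 x := by
    intro x hx
    refine (((hA x hx).pow 2).add ((hB x hx).pow 2)).congr_deriv ?_
    simp only [Nat.cast_ofNat]
    ring
  have h0 : (0 : ℝ) ∈ I := ⟨by linarith [Real.pi_pos], by linarith [Real.pi_pos]⟩
  have hconst : A ψ ^ 2 + B ψ ^ 2 = A 0 ^ 2 + B 0 ^ 2 := by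
    refine (convex_Ioo _ _).is_const_of_fderivWithin_eq_zero (𝕜 := ℝ) (s := I)
      (f := fun x => A x ^ 2 + B x ^ 2)
      (fun x hx => (hE x hx).differentiableAt.differentiableWithinAt) (fun x hx => ?_) hψ h0
    rw [fderivWithin_of_isOpen isOpen_Ioo hx]
    simpa using (hE x hx).hasFDerivAt.fderiv
  have hz : A 0 ^ 2 + B 0 ^ 2 = 0 := by simp [A, B]
  rw [hz] at hconst
  have hAz : A ψ = 0 := by nlinarith [sq_nonneg (A ψ), sq_nonneg (B ψ)]
  have hBz : B ψ = 0 := by nlinarith [sq_nonneg (A ψ), sq_nonneg (B ψ)]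
  exact ⟨sub_eq_zero.1 hAz, sub_eq_zero.1 hBz⟩

end QGadget

/-! ### Truncations that stay in the unit disc -/

namespace QGadget

open Finset

/-- A polynomial in `t ^ 2` of degree `N` that approximates `cos (arcsin t / 4)` from below. -/
noncomputable def quarterCos (N : ℕ) (t : ℝ) : ℝ :=
  1 - ∑ j ∈ range N, quarterCoeff j * t ^ (2 * (j + 1)) - t ^ (2 * N)

/-- An odd polynomial in `t` that approximates `sin (arcsin t / 4) / √(1 - t ^ 2)`. -/
noncomputable def quarterSin (N : ℕ) (t : ℝ) : ℝ :=
  ∑ j ∈ range N, 8 * ((j + 1) * quarterCoeff j) * t ^ (2 * j + 1)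

theorem quarterCos_eq (N : ℕ) (t : ℝ) :
    quarterCos N t
      = 1 - t ^ 2 * (∑ j ∈ range N, quarterCoeff j * (t ^ 2) ^ j) - (t ^ 2) ^ N := by
  rw [quarterCos, mul_sum, pow_mul]
  congr 2
  exact sum_congr rfl fun j _ => by ring

theorem quarterSin_eq (N : ℕ) (t : ℝ) :
    quarterSin N t = 8 * t * ∑ j ∈ range N, ((j + 1) * quarterCoeff j) * (t ^ 2) ^ j := by
  rw [quarterSin, mul_sum]
  exact sum_congr rfl fun j _ => by ring

/-- Truncation of a series with nonnegative coefficients. -/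
theorem tsum_sub_sum_range_mem {c : ℕ → ℝ} {u s T : ℝ} (N : ℕ) (hc : ∀ j, 0 ≤ c j) (hu : 0 ≤ u)
    (hs : HasSum (fun j => c j * u ^ j) s) (hT : HasSum (fun j => c (j + N) * u ^ j) T) :
    0 ≤ s - ∑ j ∈ range N, c j * u ^ j ∧ s - ∑ j ∈ range N, c j * u ^ j = u ^ N * T := by
  have h1 := (hasSum_nat_add_iff' N).2 hs
  have h2 : s - ∑ j ∈ range N, c j * u ^ j = u ^ N * T :=
    h1.unique ((hT.mul_left (u ^ N)).congr_fun fun j => by ring)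
  refine ⟨h1.nonneg fun j => ?_, h2⟩
  have := hc (j + N)
  positivity

/-- All coefficients together sum to at most 3/32, so the factor left after extracting u^N is below
1, uniformly up to u = 1. -/
theorem quarterSeries_sub_sum_range_mem (N : ℕ) {u : ℝ} (hu : 0 ≤ u) (hu1 : u < 1) :
    quarterSeries u - ∑ j ∈ range N, quarterCoeff j * u ^ j ∈ Set.Icc 0 (u ^ N) := by
  have ha : |u| < 1 := by rwa [abs_of_nonneg hu]
  have hle : ∀ j, quarterCoeff (j + N) * u ^ j ≤ quarterCoeff (j + N) := fun j =>
    mul_le_of_le_one_right (quarterCoeff_nonneg _) (pow_le_one₀ hu hu1.le)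
  have hsN := (summable_nat_add_iff N).2 summable_quarterCoeff
  have hT : Summable fun j => quarterCoeff (j + N) * u ^ j :=
    hsN.of_nonneg_of_le (fun j => mul_nonneg (quarterCoeff_nonneg _) (pow_nonneg hu _)) hle
  obtain ⟨h1, h2⟩ := tsum_sub_sum_range_mem N quarterCoeff_nonneg hu (hasSum_quarterSeries ha)
    hT.hasSum
  refine ⟨h1, h2.trans_le (mul_le_of_le_one_right (pow_nonneg hu _) ?_)⟩
  refine (hT.tsum_le_tsum hle hsN).trans ?_
  have h3 := summable_quarterCoeff.sum_add_tsum_nat_add N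
  have h4 := Real.tsum_le_of_sum_range_le quarterCoeff_nonneg sum_range_quarterCoeff_le
  have h5 := sum_nonneg fun j (_ : j ∈ range N) => quarterCoeff_nonneg j
  linarith

theorem quarterDeriv_sub_sum_range_mem (N : ℕ) {u : ℝ} (hu : 0 ≤ u) (hu1 : u < 1) :
    quarterDeriv u - ∑ j ∈ range N, ((j + 1) * quarterCoeff j) * u ^ j
      ∈ Set.Icc 0 (u ^ N / (32 * (1 - u))) := by
  have ha : |u| < 1 := by rwa [abs_of_nonneg hu]
  have hc : ∀ j : ℕ, 0 ≤ (j + 1) * quarterCoeff j := fun j =>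
    mul_nonneg (by positivity) (quarterCoeff_nonneg j)
  have hle : ∀ j : ℕ, (((j + N : ℕ) : ℝ) + 1) * quarterCoeff (j + N) * u ^ j ≤ 1 / 32 * u ^ j :=
    fun j => mul_le_mul_of_nonneg_right (mul_quarterCoeff_le _) (pow_nonneg hu _)
  have hg := (hasSum_geometric_of_lt_one hu hu1).mul_left (1 / 32)
  have hT : Summable fun j : ℕ => (((j + N : ℕ) : ℝ) + 1) * quarterCoeff (j + N) * u ^ j :=
    hg.summable.of_nonneg_of_le (fun j => mul_nonneg (hc _) (pow_nonneg hu _)) hle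
  obtain ⟨h1, h2⟩ := tsum_sub_sum_range_mem (c := fun j : ℕ => (j + 1) * quarterCoeff j) N hc hu
    (hasSum_quarterDeriv ha) hT.hasSum
  refine ⟨h1, h2.trans_le ?_⟩
  have h3 := hasSum_le hle hT.hasSum hg
  calc _ ≤ u ^ N * (1 / 32 * (1 - u)⁻¹) := mul_le_mul_of_nonneg_left h3 (pow_nonneg hu _)
    _ = _ := by
      have : 1 - u ≠ 0 := by linarith
      field_simp

theorem arcsin_mem_Ioo {t : ℝ} (ht : |t| < 1) :
    Real.arcsin t ∈ Set.Ioo (-(Real.pi / 2)) (Real.pi / 2) := by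
  rw [abs_lt] at ht
  exact ⟨Real.neg_pi_div_two_lt_arcsin.2 ht.1, Real.arcsin_lt_pi_div_two.2 ht.2⟩

theorem sq_lt_one_of_abs_lt_one {t : ℝ} (ht : |t| < 1) : t ^ 2 < 1 := by
  rwa [sq_lt_one_iff_abs_lt_one]

/-- Dropping the tail of the series overshoots the cosine by at most t² · t^(2N); the extra −t^(2N)
in `quarterCos` more than compensates. -/
theorem cos_arcsin_sub_quarterCos_mem (N : ℕ) {t : ℝ} (ht : |t| < 1) :
    Real.cos (Real.arcsin t / 4) - quarterCos N t ∈ Set.Icc 0 ((t ^ 2) ^ N) := by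
  have hψ := arcsin_mem_Ioo ht
  have hsin : Real.sin (Real.arcsin t) = t :=
    Real.sin_arcsin (abs_lt.1 ht).1.le (abs_lt.1 ht).2.le
  have h1 := (quarterSeries_sin_sq hψ).1
  rw [hsin] at h1
  have h2 := quarterSeries_sub_sum_range_mem N (sq_nonneg t) (sq_lt_one_of_abs_lt_one ht)
  rw [← h1, quarterCos_eq]
  have h0 : 0 ≤ (t ^ 2) ^ N := by positivity
  have h3 := sq_lt_one_of_abs_lt_one ht
  have h4 := sq_nonneg t
  have h5 := mul_nonneg h4 h2.1
  have h6 := mul_le_mul h3.le h2.2 h2.1 zero_le_one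
  constructor <;> linarith

theorem sin_arcsin_eq_mul {t : ℝ} (ht : |t| < 1) :
    Real.sin (Real.arcsin t / 4) = 8 * t * √(1 - t ^ 2) * quarterDeriv (t ^ 2) := by
  have hsin : Real.sin (Real.arcsin t) = t :=
    Real.sin_arcsin (abs_lt.1 ht).1.le (abs_lt.1 ht).2.le
  have h1 := (quarterSeries_sin_sq (arcsin_mem_Ioo ht)).2
  rw [hsin, Real.cos_arcsin] at h1
  exact h1.symm

/-- The coefficients are nonnegative, so truncation can only decrease the modulus. -/
theorem quarterSin_sq_le (N : ℕ) {t : ℝ} (ht : |t| < 1) :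
    (1 - t ^ 2) * quarterSin N t ^ 2 ≤ Real.sin (Real.arcsin t / 4) ^ 2 := by
  have h3 := sq_lt_one_of_abs_lt_one ht
  have h2 := quarterDeriv_sub_sum_range_mem N (sq_nonneg t) h3
  have h0 : 0 ≤ ∑ j ∈ range N, ((j + 1) * quarterCoeff j) * (t ^ 2) ^ j :=
    sum_nonneg fun j _ => by
      have := quarterCoeff_nonneg j
      positivity
  have h4 := pow_le_pow_left₀ h0 (sub_nonneg.1 h2.1) 2
  have hs : √(1 - t ^ 2) ^ 2 = 1 - t ^ 2 := Real.sq_sqrt (by linarith)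
  rw [sin_arcsin_eq_mul ht, quarterSin_eq, mul_right_comm (8 * t), mul_pow _ √_, hs, mul_pow,
    mul_pow]
  have h5 : 0 ≤ (1 - t ^ 2) * (8 * t) ^ 2 := mul_nonneg (by linarith) (sq_nonneg _)
  nlinarith [mul_le_mul_of_nonneg_left h4 h5]

/-- The two polynomials never leave the unit disc. -/
theorem quarterCos_sq_add_le_one (N : ℕ) {t : ℝ} (ht : |t| ≤ 1) :
    quarterCos N t ^ 2 + (1 - t ^ 2) * quarterSin N t ^ 2 ≤ 1 := by
  rcases ht.lt_or_eq with ht | ht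
  · have h1 := cos_arcsin_sub_quarterCos_mem N ht
    have h2 := quarterSin_sq_le N ht
    have h3 := Real.sin_sq_add_cos_sq (Real.arcsin t / 4)
    have h4 : (t ^ 2) ^ N ≤ 1 := pow_le_one₀ (sq_nonneg t) (sq_lt_one_of_abs_lt_one ht).le
    -- The truncation may be as low as cos − 1; since cos ≥ 1/2 this is still at least −cos, which
    -- is what squaring needs.
    have h5 : 1 / 2 ≤ Real.cos (Real.arcsin t / 4) := by
      rw [← Real.cos_pi_div_three, ← Real.cos_abs (Real.arcsin t / 4)]
      have := abs_le.2 ⟨Real.neg_pi_div_two_le_arcsin t, Real.arcsin_le_pi_div_two t⟩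
      refine Real.cos_le_cos_of_nonneg_of_le_pi (abs_nonneg _) ?_ ?_
      · linarith [Real.pi_pos]
      · rw [abs_div, abs_of_pos (four_pos : (0 : ℝ) < 4)]
        linarith [Real.pi_pos]
    have h6 : quarterCos N t ^ 2 ≤ Real.cos (Real.arcsin t / 4) ^ 2 :=
      sq_le_sq' (by linarith [h1.2]) (by linarith [h1.1])
    linarith
  -- At the endpoints the sine part has weight 0 and the cosine part collapses to minus a partial
  -- sum of coefficients.
  · have ht2 : t ^ 2 = 1 := by rw [← sq_abs, ht, one_pow]
    have h1 := sum_range_quarterCoeff_le N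
    have h0 := sum_nonneg fun j (_ : j ∈ range N) => quarterCoeff_nonneg j
    have e : quarterCos N t = - ∑ j ∈ range N, quarterCoeff j := by
      rw [quarterCos_eq, ht2]
      simp
    rw [e, ht2]
    nlinarith

/-- The approximation error away from the endpoints. -/
theorem abs_quarterCos_sub_le (N : ℕ) {t δ : ℝ} (hδ : 0 < δ) (ht : |t| ≤ 1 - δ) :
    |quarterCos N t - Real.cos (Real.arcsin t / 4)| ≤ (1 - δ) ^ (2 * N) := by
  have h1 := cos_arcsin_sub_quarterCos_mem N (t := t) (by linarith)
  rw [abs_sub_comm, abs_of_nonneg h1.1, pow_mul]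
  refine h1.2.trans (pow_le_pow_left₀ (sq_nonneg t) ?_ N)
  rw [← sq_abs]
  exact pow_le_pow_left₀ (abs_nonneg t) ht 2

theorem abs_quarterSin_sub_le (N : ℕ) {t δ : ℝ} (hδ : 0 < δ) (hδ1 : δ ≤ 1) (ht : |t| ≤ 1 - δ) :
    |√(1 - t ^ 2) * quarterSin N t - Real.sin (Real.arcsin t / 4)| ≤ (1 - δ) ^ (2 * N) / δ := by
  have ht1 : |t| < 1 := by linarith
  have h2 := quarterDeriv_sub_sum_range_mem N (sq_nonneg t) (sq_lt_one_of_abs_lt_one ht1)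
  have hsq : t ^ 2 ≤ (1 - δ) ^ 2 := by
    rw [← sq_abs]
    exact pow_le_pow_left₀ (abs_nonneg t) ht 2
  have hd : δ ≤ 1 - t ^ 2 := by nlinarith
  have hs1 : √(1 - t ^ 2) ≤ 1 := Real.sqrt_le_one.2 (by linarith [sq_nonneg t])
  rw [sin_arcsin_eq_mul ht1, quarterSin_eq, abs_sub_comm]
  have e : 8 * t * √(1 - t ^ 2) * quarterDeriv (t ^ 2) - √(1 - t ^ 2) *
      (8 * t * ∑ j ∈ range N, ((j + 1) * quarterCoeff j) * (t ^ 2) ^ j)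
      = 8 * (|√(1 - t ^ 2)| * t) * (quarterDeriv (t ^ 2)
        - ∑ j ∈ range N, ((j + 1) * quarterCoeff j) * (t ^ 2) ^ j) := by
    rw [abs_of_nonneg (Real.sqrt_nonneg _)]
    ring
  rw [e, abs_mul, abs_mul, abs_mul, abs_abs, abs_of_nonneg h2.1, abs_of_nonneg (Real.sqrt_nonneg _),
    abs_of_pos (by norm_num : (0 : ℝ) < 8)]
  calc 8 * (√(1 - t ^ 2) * |t|) * _ ≤ 8 * (1 * 1) * ((t ^ 2) ^ N / (32 * (1 - t ^ 2))) := by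
        gcongr
        · exact h2.1
        · exact h2.2
    _ ≤ 8 * (1 * 1) * (((1 - δ) ^ 2) ^ N / (32 * δ)) := by gcongr
    _ ≤ _ := by
        rw [pow_mul]
        have : 0 ≤ ((1 - δ) ^ 2) ^ N / δ := by positivity
        calc _ = 1 / 4 * (((1 - δ) ^ 2) ^ N / δ) := by field_simp; ring
          _ ≤ _ := by linarith

end QGadget

/-! ### Fejér–Riesz and completion to a unit vector -/

namespace QGadget

open Polynomial ComplexConjugate

/-- The polynomial whose values on the unit circle are `w ^ D * conj (p w)`. -/
noncomputable def conjReflect (D : ℕ) (p : ℂ[X]) : ℂ[X] := (p.map (starRingEnd ℂ)).reflect D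

/-- Needed off the circle too: for a polynomial equal to its own reflection it turns a nonzero root
r into the root 1/conj r. -/
theorem eval_conjReflect_mul_pow {D : ℕ} {p : ℂ[X]} (hp : p.natDegree ≤ D) {x : ℂ} (hx : x ≠ 0) :
    (conjReflect D p).eval (conj x)⁻¹ * conj x ^ D = conj (p.eval x) := by
  have hx' : conj x ≠ 0 := (_root_.map_ne_zero _).2 hx
  let := invertibleOfNonzero hx'
  have h := eval₂_reflect_mul_pow (RingHom.id ℂ) (conj x) D (p.map (starRingEnd ℂ))
    (natDegree_map_le.trans hp)
  rw [invOf_eq_inv] at h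
  rw [conjReflect, eval, h, ← eval, eval_map_apply]

theorem conj_eq_inv_of_norm_eq_one {w : ℂ} (hw : ‖w‖ = 1) : conj w = w⁻¹ :=
  (Complex.inv_eq_conj hw).symm

theorem ne_zero_of_norm_eq_one {w : ℂ} (hw : ‖w‖ = 1) : w ≠ 0 := by
  rintro rfl
  simp at hw

theorem eval_conjReflect {D : ℕ} {p : ℂ[X]} (hp : p.natDegree ≤ D) {w : ℂ} (hw : ‖w‖ = 1) :
    (conjReflect D p).eval w = w ^ D * conj (p.eval w) := by
  have hw0 := ne_zero_of_norm_eq_one hw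
  have h := eval_conjReflect_mul_pow hp hw0
  rw [conj_eq_inv_of_norm_eq_one hw, inv_inv, inv_pow] at h
  rw [← h]
  field_simp

theorem natDegree_conjReflect_le {D : ℕ} {p : ℂ[X]} (hp : p.natDegree ≤ D) :
    (conjReflect D p).natDegree ≤ D := by
  rw [natDegree_le_iff_coeff_eq_zero]
  intro k hk
  rw [conjReflect, coeff_reflect, revAt_eq_self_of_lt hk, coeff_map,
    coeff_eq_zero_of_natDegree_lt (hp.trans_lt hk), map_zero]

theorem coeff_zero_conjReflect (D : ℕ) (p : ℂ[X]) :
    (conjReflect D p).coeff 0 = conj (p.coeff D) := by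
  simp [conjReflect, coeff_reflect, revAt_le]

/-- Polynomials that agree on the unit circle are equal. -/
theorem eq_of_eval_eq_on_circle {p q : ℂ[X]} (h : ∀ w : ℂ, ‖w‖ = 1 → p.eval w = q.eval w) :
    p = q := by
  -- The points e^{in}, n ∈ ℕ, lie on the circle and are distinct because π is irrational.
  refine eq_of_infinite_eval_eq p q (Set.Infinite.mono (s := Set.range fun n : ℕ =>
    Complex.exp (((n : ℝ) : ℂ) * Complex.I)) ?_ ?_)
  · rintro _ ⟨n, rfl⟩
    exact h _ (Complex.norm_exp_ofReal_mul_I _)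
  · refine Set.infinite_range_of_injective fun m n hmn => ?_
    obtain ⟨k, hk⟩ := Complex.exp_eq_exp_iff_exists_int.1 hmn
    have hk' : (m : ℝ) = n + k * (2 * Real.pi) := by
      have : ((m : ℝ) : ℂ) = (n : ℝ) + k * (2 * Real.pi) := by
        refine mul_right_cancel₀ Complex.I_ne_zero ?_
        rw [hk]
        ring
      exact_mod_cast this
    rcases eq_or_ne k 0 with rfl | hk0
    · simpa using hk'
    · exfalso
      refine irrational_pi ⟨((m : ℚ) - n) / (k * 2), ?_⟩
      have : (k : ℝ) ≠ 0 := Int.cast_ne_zero.2 hk0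
      push_cast
      rw [hk']
      field_simp
      ring

/-- **Fejér–Riesz** for strictly positive trigonometric polynomials: if `w ^ (-D) * P w` is a
positive real on the unit circle, then it is `‖g w‖ ^ 2` for a polynomial `g`. -/
theorem exists_eval_eq_norm_sq_mul_pow (D : ℕ) (P : ℂ[X]) (hP : P.natDegree ≤ 2 * D)
    (hpos : ∀ w : ℂ, ‖w‖ = 1 → ∃ r : ℝ, 0 < r ∧ P.eval w = r * w ^ D) :
    ∃ g : ℂ[X], g.natDegree ≤ D ∧
      ∀ w : ℂ, ‖w‖ = 1 → P.eval w = ((‖g.eval w‖ ^ 2 : ℝ) : ℂ) * w ^ D := by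
  induction D generalizing P with
  | zero =>
    obtain ⟨r, hr, h⟩ := hpos 1 norm_one
    rw [eq_C_of_natDegree_le_zero hP] at h ⊢
    refine ⟨C (√r : ℂ), by simp, fun w _ => ?_⟩
    simp only [eval_C, pow_zero, mul_one] at h ⊢
    rw [h, Complex.norm_real, Real.norm_eq_abs, sq_abs, Real.sq_sqrt hr.le]
  | succ D ih =>
    -- Being real on the circle after division by w^(D+1), P equals its own reflection.
    have hself : P = conjReflect (2 * (D + 1)) P := by
      refine eq_of_eval_eq_on_circle fun w hw => ?_
      obtain ⟨r, hr, h⟩ := hpos w hw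
      have hw0 := ne_zero_of_norm_eq_one hw
      rw [eval_conjReflect hP hw, h, map_mul, map_pow, Complex.conj_ofReal,
        conj_eq_inv_of_norm_eq_one hw, two_mul, pow_add, inv_pow]
      field_simp
      ring
    have hlead : P.coeff 0 = conj (P.coeff (2 * (D + 1))) := by
      conv_lhs => rw [hself]
      rw [coeff_zero_conjReflect]
    rcases eq_or_ne (P.coeff 0) 0 with h0 | h0
    -- By the symmetry the top coefficient vanishes with the constant one, so dividing by X lowers
    -- the degree bound by two.
    · have hdeg : P.natDegree ≤ 2 * D + 1 := by
        rw [natDegree_le_iff_coeff_eq_zero]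
        intro k hk
        rcases (Nat.succ_le_of_lt hk).eq_or_lt with rfl | hk'
        · rw [h0] at hlead
          exact (map_eq_zero _).1 hlead.symm
        · exact coeff_eq_zero_of_natDegree_lt (by omega)
      obtain ⟨Q, rfl⟩ := X_dvd_iff.2 h0
      have hQ : Q.natDegree ≤ 2 * D := by
        rcases eq_or_ne Q 0 with rfl | hQ0
        · simp
        · rw [natDegree_X_mul hQ0] at hdeg
          omega
      obtain ⟨g, hg, hgw⟩ := ih Q hQ fun w hw => by
        obtain ⟨r, hr, h⟩ := hpos w hw
        refine ⟨r, hr, mul_left_cancel₀ (ne_zero_of_norm_eq_one hw) ?_⟩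
        rw [eval_mul, eval_X] at h
        rw [h]
        ring
      refine ⟨g, hg.trans D.le_succ, fun w hw => ?_⟩
      rw [eval_mul, eval_X, hgw w hw]
      ring
    · have hne : P.coeff (2 * (D + 1)) ≠ 0 := fun h => h0 (by rw [hlead, h, map_zero])
      have hdeg : P.natDegree = 2 * (D + 1) := hP.antisymm (le_natDegree_of_ne_zero hne)
      obtain ⟨r, hr⟩ := Complex.exists_root (f := P) (natDegree_pos_iff_degree_pos.1 (by omega))
      have hr0 : r ≠ 0 := by
        rintro rfl
        rw [IsRoot.def, ← coeff_zero_eq_eval_zero] at hr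
        exact h0 hr
      have hcr0 : conj r ≠ 0 := (_root_.map_ne_zero _).2 hr0
      have hr1 : ‖r‖ ≠ 1 := fun h1 => by
        obtain ⟨ρ, hρ, h⟩ := hpos r h1
        rw [hr.eq_zero] at h
        exact mul_ne_zero (Complex.ofReal_ne_zero.2 hρ.ne') (pow_ne_zero _ hr0) h.symm
      set s := (conj r)⁻¹ with hs
      have hsr : s * conj r = 1 := inv_mul_cancel₀ hcr0
      have hs0 : s ≠ 0 := inv_ne_zero hcr0
      have hsroot : P.eval s = 0 := by
        have h := eval_conjReflect_mul_pow hP hr0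
        rw [← hself, hr.eq_zero, map_zero] at h
        exact (mul_eq_zero.1 h).resolve_right (pow_ne_zero _ hcr0)
      have hsne : s - r ≠ 0 := fun h => hr1 <| by
        rw [sub_eq_zero.1 h, Complex.mul_conj, Complex.normSq_eq_norm_sq] at hsr
        have h2 : ‖r‖ ^ 2 = 1 := by exact_mod_cast hsr
        nlinarith [norm_nonneg r]
      obtain ⟨P₁, rfl⟩ := dvd_iff_isRoot.2 hr
      rw [eval_mul, eval_sub, eval_X, eval_C] at hsroot
      obtain ⟨P₂, rfl⟩ := dvd_iff_isRoot.2 ((mul_eq_zero.1 hsroot).resolve_left hsne)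
      have hP₂ : P₂.natDegree = 2 * D := by
        have hP₂0 : P₂ ≠ 0 := by
          rintro rfl
          simp at h0
        rw [natDegree_mul (X_sub_C_ne_zero _) (mul_ne_zero (X_sub_C_ne_zero _) hP₂0),
          natDegree_mul (X_sub_C_ne_zero _) hP₂0, natDegree_X_sub_C, natDegree_X_sub_C] at hdeg
        omega
      -- On the circle the pair of reflected roots contributes |w−r|² w up to the constant −s.
      -- Moving −s into the cofactor keeps that cofactor positive, so the induction applies.
      have hfac : ∀ w : ℂ, ‖w‖ = 1 → (w - r) * (w - s)
          = ((‖w - r‖ ^ 2 : ℝ) : ℂ) * w * (-s) := fun w hw => by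
        have hww : w * conj w = 1 := by
          rw [conj_eq_inv_of_norm_eq_one hw, mul_inv_cancel₀ (ne_zero_of_norm_eq_one hw)]
        rw [← Complex.normSq_eq_norm_sq, ← Complex.mul_conj, map_sub]
        linear_combination (w - r) * (s * hww - w * hsr)
      obtain ⟨g, hg, hgw⟩ := ih (C (-s) * P₂) (natDegree_C_mul_le _ _ |>.trans hP₂.le)
        fun w hw => by
        obtain ⟨ρ, hρ, h⟩ := hpos w hw
        have hwr : w - r ≠ 0 := fun h' => hr1 (by rw [← sub_eq_zero.1 h', hw])
        have hn : 0 < ‖w - r‖ ^ 2 := by positivity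
        refine ⟨ρ / ‖w - r‖ ^ 2, by positivity, ?_⟩
        simp only [eval_mul, eval_sub, eval_X, eval_C] at h ⊢
        rw [← mul_assoc, hfac w hw] at h
        have hnc : ((‖w - r‖ ^ 2 : ℝ) : ℂ) ≠ 0 := Complex.ofReal_ne_zero.2 hn.ne'
        refine mul_left_cancel₀ (mul_ne_zero hnc (ne_zero_of_norm_eq_one hw)) ?_
        rw [Complex.ofReal_div, ← mul_assoc, h]
        field_simp
        ring
      refine ⟨(X - C r) * g, ?_, fun w hw => ?_⟩
      · refine natDegree_mul_le.trans ?_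
        rw [natDegree_X_sub_C]
        omega
      · have h := hgw w hw
        simp only [eval_mul, eval_sub, eval_X, eval_C] at h ⊢
        rw [← mul_assoc, hfac w hw, mul_assoc, h, norm_mul, mul_pow]
        push_cast
        ring

/-- A polynomial that maps the unit circle into the open unit disc is completed to a unit
vector by a second polynomial of the same degree. -/
theorem exists_norm_sq_add_norm_sq_eq_one {D : ℕ} {p : ℂ[X]} (hp : p.natDegree ≤ D)
    (h1 : ∀ w : ℂ, ‖w‖ = 1 → ‖p.eval w‖ < 1) :
    ∃ q : ℂ[X], q.natDegree ≤ D ∧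
      ∀ w : ℂ, ‖w‖ = 1 → ‖p.eval w‖ ^ 2 + ‖q.eval w‖ ^ 2 = 1 := by
  -- On the circle this polynomial is w^D (1 − |p|²), the input that Fejér–Riesz asks for; |p| < 1
  -- gives the strict positivity.
  have hev : ∀ w : ℂ, ‖w‖ = 1 → (X ^ D - p * conjReflect D p).eval w
      = ((1 - ‖p.eval w‖ ^ 2 : ℝ) : ℂ) * w ^ D := fun w hw => by
    rw [eval_sub, eval_mul, eval_conjReflect hp hw, eval_pow, eval_X, ← Complex.normSq_eq_norm_sq,
      Complex.ofReal_sub, ← Complex.mul_conj]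
    push_cast
    ring
  have hdeg : (X ^ D - p * conjReflect D p).natDegree ≤ 2 * D := by
    refine (natDegree_sub_le _ _).trans (max_le ?_ ?_)
    · rw [natDegree_X_pow]
      omega
    · refine natDegree_mul_le.trans ?_
      have := natDegree_conjReflect_le hp
      omega
  obtain ⟨q, hq, hqw⟩ := exists_eval_eq_norm_sq_mul_pow D _ hdeg fun w hw =>
    ⟨_, by nlinarith [norm_nonneg (p.eval w), h1 w hw], hev w hw⟩
  refine ⟨q, hq, fun w hw => ?_⟩
  have h := hqw w hw
  rw [hev w hw] at h
  have h2 := mul_right_cancel₀ (pow_ne_zero D (ne_zero_of_norm_eq_one hw)) h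
  have h3 := Complex.ofReal_injective h2
  linarith

/-- Constant and leading coefficients of such a pair are orthogonal. -/
theorem coeff_zero_mul_conj_coeff_add_eq_zero {D : ℕ} {p q : ℂ[X]} (hp : p.natDegree ≤ D + 1)
    (hq : q.natDegree ≤ D + 1)
    (h : ∀ w : ℂ, ‖w‖ = 1 → ‖p.eval w‖ ^ 2 + ‖q.eval w‖ ^ 2 = 1) :
    p.coeff 0 * conj (p.coeff (D + 1)) + q.coeff 0 * conj (q.coeff (D + 1)) = 0 := by
  have e : p * conjReflect (D + 1) p + q * conjReflect (D + 1) q = X ^ (D + 1) := by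
    refine eq_of_eval_eq_on_circle fun w hw => ?_
    have h1 : ((‖p.eval w‖ ^ 2 + ‖q.eval w‖ ^ 2 : ℝ) : ℂ) = 1 := by rw [h w hw, Complex.ofReal_one]
    rw [← Complex.normSq_eq_norm_sq, ← Complex.normSq_eq_norm_sq, Complex.ofReal_add,
      ← Complex.mul_conj, ← Complex.mul_conj] at h1
    rw [eval_add, eval_mul, eval_mul, eval_conjReflect hp hw, eval_conjReflect hq hw, eval_pow,
      eval_X]
    linear_combination w ^ (D + 1) * h1
  have h0 := congrArg (fun r => coeff r 0) e
  simpa [mul_coeff_zero, coeff_zero_conjReflect, coeff_X_pow] using h0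

end QGadget

/-! ### SU(2) and quantum signal processing -/

namespace QGadget

open Polynomial ComplexConjugate

/-- The matrices of `SU(2)`, given by their first row. -/
def su2 (α β : ℂ) : Op := !![α, β; -conj β, conj α]

/-- Membership in `SU(2)`. -/
def IsSU2 (M : Op) : Prop := ∃ α β : ℂ, Complex.normSq α + Complex.normSq β = 1 ∧ M = su2 α β

theorem su2_mul_su2 (a b c d : ℂ) :
    su2 a b * su2 c d = su2 (a * c - b * conj d) (a * d + b * conj c) := by
  ext i j
  fin_cases i <;> fin_cases j <;> simp [su2, Matrix.mul_apply, Fin.sum_univ_two] <;> ring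

theorem normSq_mul_add_normSq_mul (a b c d : ℂ) :
    Complex.normSq (a * c - b * conj d) + Complex.normSq (a * d + b * conj c)
      = (Complex.normSq a + Complex.normSq b) * (Complex.normSq c + Complex.normSq d) := by
  simp only [Complex.normSq_apply, Complex.add_re, Complex.add_im, Complex.sub_re, Complex.sub_im,
    Complex.mul_re, Complex.mul_im, Complex.conj_re, Complex.conj_im]
  ring

theorem IsSU2.mul {M N : Op} (hM : IsSU2 M) (hN : IsSU2 N) : IsSU2 (M * N) := by
  obtain ⟨a, b, h, rfl⟩ := hM
  obtain ⟨c, d, h', rfl⟩ := hN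
  exact ⟨_, _, by rw [normSq_mul_add_normSq_mul, h, h', one_mul], su2_mul_su2 a b c d⟩

theorem isSU2_rotX (θ : ℝ) : IsSU2 (rotX θ) := by
  refine ⟨Real.cos θ, Complex.I * Real.sin θ, ?_, ?_⟩
  · rw [Complex.normSq_mul, Complex.normSq_I, Complex.normSq_ofReal, Complex.normSq_ofReal, one_mul]
    linarith [Real.sin_sq_add_cos_sq θ]
  · simp only [rotX, su2, map_mul, Complex.conj_I, Complex.conj_ofReal, neg_mul, neg_neg]

theorem su2_mem_unitaryGroup {α β : ℂ} (h : Complex.normSq α + Complex.normSq β = 1) :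
    su2 α β ∈ Matrix.unitaryGroup (Fin 2) ℂ := by
  have h' : α * conj α + β * conj β = 1 := by
    rw [Complex.mul_conj, Complex.mul_conj, ← Complex.ofReal_add, h, Complex.ofReal_one]
  rw [Matrix.mem_unitaryGroup_iff]
  ext i j
  fin_cases i <;> fin_cases j <;>
    simp [su2, Matrix.mul_apply, Fin.sum_univ_two, Matrix.star_apply] <;>
    first | linear_combination h' | ring

/-- The fixed gate with matrix `su2 α β` in the eigenbasis of `σ_x`. -/
noncomputable def xBasisGate (α β : ℂ) (h : Complex.normSq α + Complex.normSq β = 1) : Gate 1 :=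
  Gate.fixed ⟨su2 ⟨α.re, β.im⟩ ⟨-β.re, α.im⟩, su2_mem_unitaryGroup (by
    simp only [Complex.normSq_apply] at h ⊢
    linarith)⟩

theorem isSU2_xBasisGate {α β : ℂ} (h : Complex.normSq α + Complex.normSq β = 1)
    (U : Fin 1 → Op) : IsSU2 ((xBasisGate α β h).eval U) := by
  refine ⟨_, _, ?_, rfl⟩
  simp only [Complex.normSq_apply] at h ⊢
  linarith

/-- The vector with coordinates `a`, `b` in the (unnormalized) eigenbasis of `σ_x`. -/
def xVec (a b : ℂ) : Fin 2 → ℂ := ![a + b, a - b]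

theorem smul_xVec (c a b : ℂ) : c • xVec a b = xVec (c * a) (c * b) := by
  ext i
  fin_cases i <;> simp [xVec] <;> ring

theorem xBasisGate_mulVec {α β : ℂ} (h : Complex.normSq α + Complex.normSq β = 1)
    (U : Fin 1 → Op) (a b : ℂ) :
    Matrix.mulVec ((xBasisGate α β h).eval U) (xVec a b)
      = xVec (α * a + β * b) (-conj β * a + conj α * b) := by
  ext i
  fin_cases i <;>
  · simp [xBasisGate, Gate.eval, su2, xVec, Matrix.mulVec, dotProduct, Fin.sum_univ_two]
    apply Complex.ext <;> simp <;> ring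

theorem rotX_mulVec (θ : ℝ) (a b : ℂ) :
    Matrix.mulVec (rotX θ) (xVec a b)
      = xVec (Complex.exp (θ * Complex.I) * a) (Complex.exp (-(θ * Complex.I)) * b) := by
  have e1 : Complex.exp (θ * Complex.I) = Real.cos θ + Real.sin θ * Complex.I := by
    rw [Complex.exp_mul_I, Complex.ofReal_cos, Complex.ofReal_sin]
  have e2 : Complex.exp (-(θ * Complex.I)) = Real.cos θ - Real.sin θ * Complex.I := by
    rw [← neg_mul, Complex.exp_mul_I, Complex.cos_neg, Complex.sin_neg, Complex.ofReal_cos,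
      Complex.ofReal_sin]
    ring
  rw [e1, e2]
  ext i
  fin_cases i <;>
  · simp [rotX, xVec, Matrix.mulVec, dotProduct, Fin.sum_univ_two]
    ring

/-- For orthogonal `u` and `v` there is a rotation whose adjoint maps `u` to the first axis and
`v` to the second one. -/
theorem exists_rotation_of_orthogonal {u₁ u₂ v₁ v₂ : ℂ} (h : v₁ * conj u₁ + v₂ * conj u₂ = 0) :
    ∃ α β : ℂ, Complex.normSq α + Complex.normSq β = 1 ∧
      conj β * u₁ + α * u₂ = 0 ∧ conj α * v₁ - β * v₂ = 0 := by
  have key : ∀ a b : ℂ, Complex.normSq a + Complex.normSq b ≠ 0 → ∃ r : ℝ,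
      Complex.normSq (r * a) + Complex.normSq (r * b) = 1 := fun a b hab => by
    have h0 : 0 ≤ Complex.normSq a + Complex.normSq b :=
      add_nonneg (Complex.normSq_nonneg _) (Complex.normSq_nonneg _)
    refine ⟨(√(Complex.normSq a + Complex.normSq b))⁻¹, ?_⟩
    rw [Complex.normSq_mul, Complex.normSq_mul, Complex.normSq_ofReal, ← mul_add, ← mul_inv,
      Real.mul_self_sqrt h0, inv_mul_cancel₀ hab]
  have zero : ∀ a b : ℂ, Complex.normSq a + Complex.normSq b = 0 → a = 0 ∧ b = 0 :=
    fun a b hab => by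
      have ha := Complex.normSq_nonneg a
      have hb := Complex.normSq_nonneg b
      exact ⟨Complex.normSq_eq_zero.1 (by linarith), Complex.normSq_eq_zero.1 (by linarith)⟩
  by_cases hu : Complex.normSq u₁ + Complex.normSq u₂ = 0
  · obtain ⟨rfl, rfl⟩ := zero _ _ hu
    by_cases hv : Complex.normSq v₁ + Complex.normSq v₂ = 0
    · obtain ⟨rfl, rfl⟩ := zero _ _ hv
      exact ⟨1, 0, by simp, by simp, by simp⟩
    · obtain ⟨r, hr⟩ := key v₁ v₂ hv
      refine ⟨r * conj v₂, r * v₁, ?_, by simp, ?_⟩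
      · rw [Complex.normSq_mul, Complex.normSq_conj, ← Complex.normSq_mul, add_comm, hr]
      · rw [map_mul, Complex.conj_ofReal, Complex.conj_conj]
        ring
  · obtain ⟨r, hr⟩ := key u₁ u₂ hu
    refine ⟨r * u₁, -(r * conj u₂), ?_, ?_, ?_⟩
    · rw [Complex.normSq_neg, Complex.normSq_mul r (conj _), Complex.normSq_conj,
        ← Complex.normSq_mul, hr]
    · rw [map_neg, map_mul, Complex.conj_ofReal, Complex.conj_conj]
      ring
    · rw [map_mul, Complex.conj_ofReal]
      linear_combination (r : ℂ) * h

theorem Circuit.eval_cons {a : ℕ} (g : Gate a) (c : Circuit a) (U : Fin a → Op) :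
    Circuit.eval (g :: c) U = g.eval U * Circuit.eval c U := by
  simp [Circuit.eval]

/-- **Quantum signal processing**: every pair of polynomials that is a unit vector on the unit
circle is realized by a circuit whose length is linear in the degree. -/
theorem exists_circuit_of_norm_sq_add_norm_sq_eq_one (D : ℕ) (p q : ℂ[X]) (hp : p.natDegree ≤ D)
    (hq : q.natDegree ≤ D) (h : ∀ w : ℂ, ‖w‖ = 1 → ‖p.eval w‖ ^ 2 + ‖q.eval w‖ ^ 2 = 1) :
    ∃ c : Circuit 1, c.length = 2 * D + 1 ∧
      ∀ θ : ℝ, IsSU2 (c.eval fun _ => rotX θ) ∧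
        Complex.exp (θ * Complex.I) ^ D • Matrix.mulVec (c.eval fun _ => rotX θ) (xVec 1 0)
          = xVec (p.eval (Complex.exp (θ * Complex.I) ^ 2))
              (q.eval (Complex.exp (θ * Complex.I) ^ 2)) := by
  induction D generalizing p q with
  | zero =>
    have h1 := h 1 norm_one
    rw [eq_C_of_natDegree_le_zero hp, eq_C_of_natDegree_le_zero hq] at h1 ⊢
    simp only [eval_C] at h1 ⊢
    have hn : Complex.normSq (p.coeff 0) + Complex.normSq (-conj (q.coeff 0)) = 1 := by
      rw [Complex.normSq_neg, Complex.normSq_conj, Complex.normSq_eq_norm_sq,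
        Complex.normSq_eq_norm_sq, h1]
    refine ⟨[xBasisGate _ _ hn], rfl, fun θ => ⟨?_, ?_⟩⟩
    · simpa [Circuit.eval] using isSU2_xBasisGate hn _
    · rw [Circuit.eval_cons, Circuit.eval, List.map_nil, List.prod_nil, mul_one,
        xBasisGate_mulVec, pow_zero, one_smul]
      simp
  | succ D ih =>
    -- Layer stripping: as the constant and leading coefficient vectors are orthogonal, one rotation
    -- removes the constant coefficient of the first component and the leading coefficient of the
    -- second. Dividing the first by X then leaves a unit vector of degree D.
    obtain ⟨α, β, hn, hu, hv⟩ :=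
      exists_rotation_of_orthogonal (coeff_zero_mul_conj_coeff_add_eq_zero hp hq h)
    have hn' : α * conj α + β * conj β = 1 := by
      rw [Complex.mul_conj, Complex.mul_conj, ← Complex.ofReal_add, hn, Complex.ofReal_one]
    obtain ⟨p', hp'⟩ : X ∣ C (conj α) * p - C β * q := by
      rw [X_dvd_iff]
      simpa using hv
    set q' := C (conj β) * p + C α * q with hq'
    have hpdeg : p'.natDegree ≤ D := by
      rcases eq_or_ne p' 0 with rfl | h0
      · simp
      · have : (X * p').natDegree ≤ D + 1 := by
          rw [← hp']
          exact (natDegree_sub_le _ _).trans (max_le ((natDegree_C_mul_le _ _).trans hp)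
            ((natDegree_C_mul_le _ _).trans hq))
        rw [natDegree_X_mul h0] at this
        omega
    have hqdeg : q'.natDegree ≤ D := by
      rw [natDegree_le_iff_coeff_eq_zero]
      intro k hk
      rw [hq', coeff_add, coeff_C_mul, coeff_C_mul]
      rcases (Nat.succ_le_of_lt hk).eq_or_lt with rfl | hk'
      · exact hu
      · rw [coeff_eq_zero_of_natDegree_lt (hp.trans_lt hk'),
          coeff_eq_zero_of_natDegree_lt (hq.trans_lt hk')]
        ring
    have hpe : ∀ w, w * p'.eval w = conj α * p.eval w - β * q.eval w := fun w => by
      simpa using (congrArg (eval w) hp').symm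
    have hqe : ∀ w, q'.eval w = conj β * p.eval w + α * q.eval w := fun w => by
      simp [hq']
    obtain ⟨c, hc1, hc2⟩ := ih p' q' hpdeg hqdeg fun w hw => by
      have e1 : ‖p'.eval w‖ = ‖conj α * p.eval w - β * q.eval w‖ := by
        rw [← hpe, norm_mul, hw, one_mul]
      rw [e1, hqe, ← h w hw]
      simp only [← Complex.normSq_eq_norm_sq]
      have := normSq_mul_add_normSq_mul (conj α) β (p.eval w) (conj (q.eval w))
      rw [Complex.conj_conj, Complex.normSq_conj, hn, Complex.normSq_conj, one_mul] at this
      rw [← this, ← Complex.normSq_conj (conj β * _ + _)]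
      simp only [map_add, map_mul, Complex.conj_conj]
      ring_nf
    refine ⟨xBasisGate α β hn :: Gate.query 0 :: c, ?_, fun θ => ⟨?_, ?_⟩⟩
    · simp only [List.length_cons, hc1]
      ring
    · rw [Circuit.eval_cons, Circuit.eval_cons]
      exact (isSU2_xBasisGate hn _).mul ((isSU2_rotX θ).mul (hc2 θ).1)
    · rw [Circuit.eval_cons, Circuit.eval_cons, ← Matrix.mulVec_mulVec, ← Matrix.mulVec_mulVec,
        pow_succ', mul_smul, ← Matrix.mulVec_smul, ← Matrix.mulVec_smul, ← Matrix.mulVec_smul, (hc2 θ).2]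
      change Matrix.mulVec _ (_ • Matrix.mulVec (rotX θ) _) = _
      set z := Complex.exp (θ * Complex.I) with hz
      -- One factor z per query turns the oracle diag(z, z⁻¹) into diag(z², 1), which restores the
      -- factor X in the first component.
      have hzz : z * Complex.exp (-(θ * Complex.I)) = 1 := by
        rw [hz, ← Complex.exp_add, add_neg_cancel, Complex.exp_zero]
      rw [rotX_mulVec, ← hz, smul_xVec, xBasisGate_mulVec]
      congr 1
      · linear_combination α * hpe (z ^ 2) + β * q'.eval (z ^ 2) * hzz + β * hqe (z ^ 2)
          + p.eval (z ^ 2) * hn'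
      · linear_combination -conj β * hpe (z ^ 2) + conj α * q'.eval (z ^ 2) * hzz
          + conj α * hqe (z ^ 2) + q.eval (z ^ 2) * hn'

end QGadget

/-! ### Palindromes and the product circuit -/

namespace QGadget

open ComplexConjugate

/-- The anti-automorphism `A ↦ σ_z Aᴴ σ_z` on gates; it fixes `e^{iθσ_x}`. -/
noncomputable def Gate.transpose {a : ℕ} : Gate a → Gate a
  | .query j => .query j
  | .fixed W => .fixed (zGate (Real.pi / 2) * star W * zGate (-(Real.pi / 2)))

/-- The circuit read backwards, with every gate transposed. -/
noncomputable def Circuit.transpose {a : ℕ} (c : Circuit a) : Circuit a :=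
  (c.map Gate.transpose).reverse

theorem rotZ_mul_rotZ (φ ψ : ℝ) : rotZ φ * rotZ ψ = rotZ (φ + ψ) := by
  ext i j
  fin_cases i <;> fin_cases j <;>
    simp [rotZ, Matrix.mul_apply, Fin.sum_univ_two, ← Complex.exp_add] <;> ring_nf

theorem rotZ_zero : rotZ 0 = 1 := by
  ext i j
  fin_cases i <;> fin_cases j <;> simp [rotZ]

theorem rotZ_mul_su2_mul_rotZ (φ : ℝ) (α β : ℂ) :
    rotZ φ * su2 α β * rotZ (-φ) = su2 α (Complex.exp (2 * φ * Complex.I) * β) := by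
  have h1 : Complex.exp (Complex.I * φ) * Complex.exp (-(Complex.I * φ)) = 1 := by
    rw [← Complex.exp_add, add_neg_cancel, Complex.exp_zero]
  have h2 : Complex.exp (2 * φ * Complex.I)
      = Complex.exp (Complex.I * φ) * Complex.exp (Complex.I * φ) := by
    rw [← Complex.exp_add]
    ring_nf
  have h3 : conj (Complex.exp (Complex.I * φ)) = Complex.exp (-(Complex.I * φ)) := by
    rw [← Complex.exp_conj]
    simp
  rw [h2]
  ext i j
  fin_cases i <;> fin_cases j <;>
    simp only [rotZ, su2, Matrix.mul_apply, Fin.sum_univ_two, Complex.ofReal_neg, mul_neg, neg_neg,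
      map_mul, h3, Matrix.of_apply, Matrix.cons_val', Matrix.cons_val_zero, Matrix.cons_val_one,
      Matrix.cons_val_fin_one, Fin.zero_eta, Fin.mk_one, Fin.isValue]
  · linear_combination α * h1
  · ring
  · ring
  · linear_combination conj α * h1

theorem star_su2 (α β : ℂ) : star (su2 α β) = su2 (conj α) (-β) := by
  ext i j
  fin_cases i <;> fin_cases j <;> simp [su2, Matrix.star_apply]

theorem rotZ_mul_star_su2_mul_rotZ (α β : ℂ) :
    rotZ (Real.pi / 2) * star (su2 α β) * rotZ (-(Real.pi / 2)) = su2 (conj α) β := by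
  rw [star_su2, rotZ_mul_su2_mul_rotZ]
  congr 1
  have : (2 : ℂ) * ((Real.pi / 2 : ℝ) : ℂ) * Complex.I = Real.pi * Complex.I := by
    push_cast
    ring
  rw [this, Complex.exp_pi_mul_I]
  ring

theorem rotX_eq_su2 (θ : ℝ) : rotX θ = su2 (Real.cos θ) (Complex.I * Real.sin θ) := by
  simp only [rotX, su2, map_mul, Complex.conj_I, Complex.conj_ofReal, neg_mul, neg_neg]

theorem rotZ_mul_star_rotX_mul_rotZ (θ : ℝ) :
    rotZ (Real.pi / 2) * star (rotX θ) * rotZ (-(Real.pi / 2)) = rotX θ := by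
  rw [rotX_eq_su2, rotZ_mul_star_su2_mul_rotZ, Complex.conj_ofReal]

theorem Circuit.eval_append {a : ℕ} (c d : Circuit a) (U : Fin a → Op) :
    Circuit.eval (c ++ d) U = c.eval U * d.eval U := by
  simp [Circuit.eval]

theorem Circuit.eval_transpose {a : ℕ} (c : Circuit a) (θ : Fin a → ℝ) :
    c.transpose.eval (fun j => rotX (θ j))
      = rotZ (Real.pi / 2) * star (c.eval fun j => rotX (θ j)) * rotZ (-(Real.pi / 2)) := by
  induction c with
  | nil =>
    simp [Circuit.transpose, Circuit.eval, rotZ_mul_rotZ, rotZ_zero]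
  | cons g c ih =>
    have e : Circuit.transpose (g :: c) = Circuit.transpose c ++ [g.transpose] := by
      simp [Circuit.transpose]
    have hz : rotZ (-(Real.pi / 2)) * rotZ (Real.pi / 2) = 1 := by
      rw [rotZ_mul_rotZ, neg_add_cancel, rotZ_zero]
    have hg : g.transpose.eval (fun j => rotX (θ j))
        = rotZ (Real.pi / 2) * star (g.eval fun j => rotX (θ j)) * rotZ (-(Real.pi / 2)) := by
      cases g with
      | query j => exact (rotZ_mul_star_rotX_mul_rotZ (θ j)).symm
      | fixed W => rfl
    rw [e, Circuit.eval_append, ih, Circuit.eval_cons, Circuit.eval_cons, hg, star_mul]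
    simp only [Circuit.eval, List.map_nil, List.prod_nil, mul_one]
    simp only [mul_assoc]
    rw [← mul_assoc (rotZ (-(Real.pi / 2))), hz, one_mul]

/-- The circuit `c` followed by its transpose. -/
noncomputable def Circuit.palindrome {a : ℕ} (c : Circuit a) : Circuit a := c ++ c.transpose

theorem Circuit.length_palindrome {a : ℕ} (c : Circuit a) :
    c.palindrome.length = 2 * c.length := by
  rw [Circuit.palindrome, List.length_append, Circuit.transpose, List.length_reverse,
    List.length_map, two_mul]

/-- Transposition conjugates the diagonal and keeps the off-diagonal entry, so the product has a
real diagonal whatever α and β are. This makes the gadget property exact. -/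
theorem Circuit.eval_palindrome {a : ℕ} (c : Circuit a) (θ : Fin a → ℝ) {α β : ℂ}
    (h : (c.eval fun j => rotX (θ j)) = su2 α β) :
    c.palindrome.eval (fun j => rotX (θ j))
      = su2 ((Complex.normSq α - Complex.normSq β : ℝ) : ℂ) (2 * (α * β)) := by
  rw [Circuit.palindrome, Circuit.eval_append, Circuit.eval_transpose, h,
    rotZ_mul_star_su2_mul_rotZ, su2_mul_su2, Complex.conj_conj, Complex.ofReal_sub,
    ← Complex.mul_conj, ← Complex.mul_conj]
  congr 1
  ring

/-- An element of `SU(2)` with real diagonal is twisted embeddable. -/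
theorem isTwistedEmbeddable_su2 {r : ℝ} {β : ℂ} (h : r ^ 2 + Complex.normSq β = 1) :
    IsTwistedEmbeddable (su2 r β) := by
  have hβ := Complex.normSq_nonneg β
  have hr : r ^ 2 ≤ 1 := by linarith
  have hr' := abs_le.1 (sq_le_one_iff_abs_le_one r |>.1 hr)
  -- The twist multiplies the off-diagonal entry i sin θ by e^{iφ}, so φ must be the argument of −iβ
  -- = e^{iφ} sin θ.
  refine ⟨Real.arccos r, ⟨Real.arccos_nonneg r, Real.arccos_le_pi r⟩,
    Complex.arg (-Complex.I * β), ⟨(Complex.neg_pi_lt_arg _).le, Complex.arg_le_pi _⟩, ?_⟩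
  rw [rotX_eq_su2, rotZ_mul_su2_mul_rotZ, Real.cos_arccos hr'.1 hr'.2, Real.sin_arccos]
  congr 1
  have hn : √(1 - r ^ 2) = ‖-Complex.I * β‖ := by
    rw [← h, add_sub_cancel_left, Complex.normSq_eq_norm_sq, Real.sqrt_sq (norm_nonneg _), norm_mul,
      norm_neg, Complex.norm_I, one_mul]
  have e := Complex.norm_mul_exp_arg_mul_I (-Complex.I * β)
  have e2 : (2 : ℂ) * ((Complex.arg (-Complex.I * β) / 2 : ℝ) : ℂ) * Complex.I
      = Complex.arg (-Complex.I * β) * Complex.I := by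
    push_cast
    ring
  rw [hn, e2, mul_left_comm, mul_comm (Complex.exp _), e]
  linear_combination β * Complex.I_mul_I

theorem Circuit.eval_subst {a b : ℕ} (c : Circuit b) (f : Fin b → Circuit a) (U : Fin a → Op) :
    (c.subst f).eval U = c.eval fun j => (f j).eval U := by
  induction c with
  | nil => rfl
  | cons g c ih =>
    have e : Circuit.subst (g :: c) f = Circuit.subst [g] f ++ Circuit.subst c f := by
      simp [Circuit.subst]
    rw [e, Circuit.eval_append, ih, Circuit.eval_cons]
    congr 1
    cases g <;> simp [Circuit.subst, Circuit.eval, Gate.eval]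

theorem Circuit.length_subst_query (c : Circuit 1) :
    (c.subst fun _ => [Gate.query (0 : Fin 2)]).length = c.length := by
  induction c with
  | nil => rfl
  | cons g c ih =>
    have e : Circuit.subst (g :: c) (fun _ => [Gate.query (0 : Fin 2)])
        = Circuit.subst [g] (fun _ => [Gate.query (0 : Fin 2)]) ++ Circuit.subst c fun _ => [.query 0] := by
      simp [Circuit.subst]
    rw [e, List.length_append, ih, List.length_cons, add_comm]
    cases g <;> simp [Circuit.subst]

theorem productCircuit_eq : productCircuit
    = [.fixed (zGate (-(Real.pi / 4))), .query 0, .fixed (zGate (Real.pi / 4)), .query 1,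
        .fixed (zGate (-(Real.pi / 4))), .query 0, .fixed (zGate (Real.pi / 4))] := rfl

theorem length_linkProduct (c : Circuit 1) : (linkProduct c).length = 2 * c.length + 5 := by
  rw [linkProduct, productCircuit_eq]
  simp only [Circuit.subst, List.flatMap_cons, List.flatMap_nil, List.length_append,
    List.length_cons, List.length_nil, Matrix.cons_val_zero, Matrix.cons_val_one]
  have := Circuit.length_subst_query c
  rw [Circuit.subst] at this
  rw [this]
  ring

/-- The product circuit on a twisted embeddable input: the diagonal stays real. -/
theorem eval_linkProduct (c : Circuit 1) (θ₁ r : ℝ) (β : ℂ) (U : Fin 2 → Op)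
    (h : (c.eval fun _ => U 0) = su2 r β) (hU : U 1 = rotX θ₁)
    (hn : r ^ 2 + Complex.normSq β = 1) :
    ∃ β' : ℂ, (linkProduct c).eval U = su2 (((2 * r ^ 2 - 1) * Real.cos θ₁
      + 2 * r * Real.sin θ₁ * β.re : ℝ) : ℂ) β' := by
  have e : (linkProduct c).eval U = rotZ (-(Real.pi / 4)) * su2 r β * rotZ (Real.pi / 4)
      * (rotX θ₁ * (rotZ (-(Real.pi / 4)) * su2 r β * rotZ (Real.pi / 4))) := by
    rw [linkProduct, Circuit.eval_subst, productCircuit_eq]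
    have h' : (c.subst fun _ => [Gate.query 0]).eval U = su2 r β := by
      rw [Circuit.eval_subst, ← h]
      simp [Circuit.eval, Gate.eval]
    have h1 : Circuit.eval [Gate.query 1] U = rotX θ₁ := by simp [Circuit.eval, Gate.eval, hU]
    simp only [Circuit.eval_cons, Gate.eval, Matrix.cons_val_zero, Matrix.cons_val_one, h', h1]
    simp [Circuit.eval, zGate, mul_assoc]
  -- Conjugation multiplies β by e^{−iπ/2} = −i, so in the ideal case of imaginary β the entry
  -- becomes real.
  have hz : rotZ (-(Real.pi / 4)) * su2 r β * rotZ (Real.pi / 4)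
      = su2 r (-(Complex.I * β)) := by
    have := rotZ_mul_su2_mul_rotZ (-(Real.pi / 4)) r β
    rw [neg_neg] at this
    rw [this]
    congr 1
    have e2 : (2 : ℂ) * ((-(Real.pi / 4) : ℝ) : ℂ) * Complex.I
        = -(Real.pi / 2 * Complex.I) := by
      push_cast
      ring
    rw [e2, Complex.exp_neg, Complex.exp_pi_div_two_mul_I, Complex.inv_I]
    ring
  have hn' : (r : ℂ) ^ 2 + β * conj β = 1 := by
    rw [Complex.mul_conj]
    exact_mod_cast hn
  have hre : β + conj β = 2 * β.re := by
    rw [Complex.add_conj]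
    push_cast
    ring
  rw [e, hz, rotX_eq_su2, su2_mul_su2, su2_mul_su2]
  refine ⟨_, congrArg₂ su2 ?_ rfl⟩
  simp only [map_add, map_neg, map_mul, Complex.conj_I, Complex.conj_ofReal]
  push_cast
  linear_combination (-Complex.cos θ₁) * hn' + r * Complex.sin θ₁ * hre
    + (Complex.cos θ₁ * β * conj β - r * Complex.sin θ₁ * (β + conj β)) * Complex.I_mul_I

end QGadget

/-! ### The polynomial and circuit for the fourth root -/

namespace QGadget

open Polynomial ComplexConjugate Finset

/-- `w ^ N * (cos θ) ^ (2 * j)` as a polynomial in `w = exp (2 * θ * I)`. -/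
noncomputable def cosBlock (N j : ℕ) : ℂ[X] := X ^ (N - j) * (C (1 / 4) * (X + 1) ^ 2) ^ j

/-- `I * w ^ (N + 1) * sin θ * (cos θ) ^ (2 * j + 1)` as a polynomial in
`w = exp (2 * θ * I)`. -/
noncomputable def sinBlock (N j : ℕ) : ℂ[X] := C (1 / 4) * ((X + 1) * (X - 1)) * cosBlock N j

theorem natDegree_cosBlock_le {N j : ℕ} (h : j ≤ N) : (cosBlock N j).natDegree ≤ 2 * N := by
  have h1 : (C (1 / 4 : ℂ) * (X + 1) ^ 2).natDegree ≤ 2 := by compute_degree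
  have h2 := natDegree_pow_le_of_le j h1
  have h3 := natDegree_mul_le_of_le (natDegree_X_pow_le (R := ℂ) (N - j)) h2
  refine h3.trans ?_
  omega

theorem natDegree_sinBlock_le {N j : ℕ} (h : j ≤ N) :
    (sinBlock N j).natDegree ≤ 2 * (N + 1) := by
  have h1 : (C (1 / 4 : ℂ) * ((X + 1) * (X - 1))).natDegree ≤ 2 := by compute_degree
  refine (natDegree_mul_le_of_le h1 (natDegree_cosBlock_le h)).trans ?_
  omega

theorem exp_sq_add_one (θ : ℝ) : Complex.exp (θ * Complex.I) ^ 2 + 1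
    = 2 * Complex.cos θ * Complex.exp (θ * Complex.I) := by
  rw [Complex.exp_mul_I]
  linear_combination (-1 : ℂ) * Complex.sin_sq_add_cos_sq (θ : ℂ)
    + Complex.sin θ ^ 2 * Complex.I_mul_I

theorem exp_sq_sub_one (θ : ℝ) : Complex.exp (θ * Complex.I) ^ 2 - 1
    = 2 * Complex.I * Complex.sin θ * Complex.exp (θ * Complex.I) := by
  rw [Complex.exp_mul_I]
  linear_combination Complex.sin_sq_add_cos_sq (θ : ℂ)
    - Complex.sin θ ^ 2 * Complex.I_mul_I

theorem eval_cosBlock {N j : ℕ} (h : j ≤ N) (θ : ℝ) :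
    (cosBlock N j).eval (Complex.exp (θ * Complex.I) ^ 2)
      = Complex.exp (θ * Complex.I) ^ (2 * N) * Complex.cos θ ^ (2 * j) := by
  have e : (1 / 4 : ℂ) * (2 * Complex.cos θ * Complex.exp (θ * Complex.I)) ^ 2
      = Complex.exp (θ * Complex.I) ^ 2 * Complex.cos θ ^ 2 := by ring
  rw [cosBlock, eval_mul, eval_pow, eval_pow, eval_mul, eval_pow, eval_add, eval_X, eval_one, eval_C,
    exp_sq_add_one, e, mul_pow, ← mul_assoc, ← pow_add, Nat.sub_add_cancel h, pow_mul, pow_mul]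

theorem eval_sinBlock {N j : ℕ} (h : j ≤ N) (θ : ℝ) :
    (sinBlock N j).eval (Complex.exp (θ * Complex.I) ^ 2)
      = Complex.exp (θ * Complex.I) ^ (2 * (N + 1))
        * (Complex.I * Complex.sin θ * Complex.cos θ ^ (2 * j + 1)) := by
  rw [sinBlock, eval_mul, eval_cosBlock h, eval_mul, eval_mul, eval_C, eval_add, eval_sub, eval_X,
    eval_one, exp_sq_add_one, exp_sq_sub_one]
  ring

/-- The polynomial of the signal processing circuit for the fourth root of `e^{iθσ_x}`. -/
noncomputable def quarterPoly (N : ℕ) : ℂ[X] :=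
  cosBlock (N + 1) 0
    - ∑ j ∈ range (N + 1), C (quarterCoeff j : ℂ) * cosBlock (N + 1) (j + 1)
    - cosBlock (N + 1) (N + 1)
    - ∑ j ∈ range (N + 1), C (8 * ((j + 1) * quarterCoeff j : ℝ) : ℂ) * sinBlock N j

theorem natDegree_quarterPoly_le (N : ℕ) : (quarterPoly N).natDegree ≤ 2 * (N + 1) := by
  have hs : ∀ j ∈ range (N + 1),
      (C (8 * ((j + 1) * quarterCoeff j : ℝ) : ℂ) * sinBlock N j).natDegree ≤ 2 * (N + 1) :=
    fun j hj => (natDegree_C_mul_le _ _).trans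
      (natDegree_sinBlock_le (Nat.lt_succ_iff.1 (mem_range.1 hj)))
  have hc : ∀ j ∈ range (N + 1),
      (C (quarterCoeff j : ℂ) * cosBlock (N + 1) (j + 1)).natDegree ≤ 2 * (N + 1) :=
    fun j hj => (natDegree_C_mul_le _ _).trans (natDegree_cosBlock_le (mem_range.1 hj))
  exact natDegree_sub_le_of_le (natDegree_sub_le_of_le (natDegree_sub_le_of_le
    (natDegree_cosBlock_le (Nat.zero_le _)) (natDegree_sum_le_of_forall_le _ _ hc))
    (natDegree_cosBlock_le le_rfl)) (natDegree_sum_le_of_forall_le _ _ hs) |>.trans (by simp)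

/-- At t = −cos θ the even powers are those of cos θ and the odd ones change sign, which is why the
sine blocks enter `quarterPoly` with a minus. -/
theorem eval_quarterPoly (N : ℕ) (θ : ℝ) :
    (quarterPoly N).eval (Complex.exp (θ * Complex.I) ^ 2)
      = Complex.exp (θ * Complex.I) ^ (2 * (N + 1))
        * (quarterCos (N + 1) (-Real.cos θ)
          + (Real.sin θ * quarterSin (N + 1) (-Real.cos θ) : ℝ) * Complex.I) := by
  have h1 : ∑ j ∈ range (N + 1), (C (quarterCoeff j : ℂ) * cosBlock (N + 1) (j + 1)).eval
      (Complex.exp (θ * Complex.I) ^ 2) = Complex.exp (θ * Complex.I) ^ (2 * (N + 1))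
        * ((∑ j ∈ range (N + 1), quarterCoeff j * (-Real.cos θ) ^ (2 * (j + 1)) : ℝ) : ℂ) := by
    push_cast
    rw [mul_sum]
    refine sum_congr rfl fun j hj => ?_
    rw [eval_mul, eval_C, eval_cosBlock (j := j + 1) (mem_range.1 hj), (even_two_mul _).neg_pow]
    ring
  have h2 : ∑ j ∈ range (N + 1), (C (8 * ((j + 1) * quarterCoeff j : ℝ) : ℂ) * sinBlock N j).eval
      (Complex.exp (θ * Complex.I) ^ 2) = -(Complex.exp (θ * Complex.I) ^ (2 * (N + 1))
        * ((Real.sin θ * quarterSin (N + 1) (-Real.cos θ) : ℝ) * Complex.I)) := by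
    rw [quarterSin]
    push_cast
    rw [mul_sum, sum_mul, mul_sum, ← sum_neg_distrib]
    refine sum_congr rfl fun j hj => ?_
    rw [eval_mul, eval_C, eval_sinBlock (Nat.lt_succ_iff.1 (mem_range.1 hj)),
      (odd_two_mul_add_one _).neg_pow]
    ring
  rw [quarterPoly, eval_sub, eval_sub, eval_sub, eval_finsetSum, eval_finsetSum, h1, h2,
    eval_cosBlock (Nat.zero_le _), eval_cosBlock le_rfl, quarterCos, (even_two_mul (N + 1)).neg_pow]
  push_cast
  ring

theorem norm_eval_quarterPoly_le_one (N : ℕ) {w : ℂ} (hw : ‖w‖ = 1) :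
    ‖(quarterPoly N).eval w‖ ≤ 1 := by
  have e : w = Complex.exp ((Complex.arg w / 2 : ℝ) * Complex.I) ^ 2 := by
    have h := Complex.norm_mul_exp_arg_mul_I w
    rw [hw, Complex.ofReal_one, one_mul] at h
    rw [← Complex.exp_nat_mul]
    conv_lhs => rw [← h]
    congr 1
    push_cast
    ring
  rw [e, eval_quarterPoly, norm_mul, norm_pow, Complex.norm_exp_ofReal_mul_I, one_pow, one_mul,
    ← sq_le_one_iff₀ (norm_nonneg _), ← Complex.normSq_eq_norm_sq, Complex.normSq_add_mul_I, mul_pow]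
  set θ := Complex.arg w / 2
  have h := quarterCos_sq_add_le_one (N + 1) (t := -Real.cos θ)
    (by rw [abs_neg]; exact Real.abs_cos_le_one θ)
  rwa [neg_sq, ← Real.sin_sq] at h

/-- Error of the quarter-angle polynomial away from the endpoints. -/
theorem norm_quarter_sub_exp_le (N : ℕ) {θ δ : ℝ} (hδ : 0 < δ) (hδ1 : δ ≤ 1)
    (hθ : θ ∈ Set.Icc 0 Real.pi) (hc : |Real.cos θ| ≤ 1 - δ) :
    ‖(quarterCos N (-Real.cos θ) + (Real.sin θ * quarterSin N (-Real.cos θ) : ℝ) * Complex.I : ℂ)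
      - Complex.exp (((θ - Real.pi / 2) / 4 : ℝ) * Complex.I)‖ ≤ 2 * ((1 - δ) ^ (2 * N) / δ) := by
  have ht : |-Real.cos θ| ≤ 1 - δ := by rwa [abs_neg]
  have hs : √(1 - (-Real.cos θ) ^ 2) = Real.sin θ := by
    rw [neg_sq, ← Real.sin_sq, Real.sqrt_sq (Real.sin_nonneg_of_mem_Icc hθ)]
  have ha : Real.arcsin (-Real.cos θ) = θ - Real.pi / 2 := by
    rw [← Real.sin_sub_pi_div_two]
    exact Real.arcsin_sin (by linarith [hθ.1]) (by linarith [hθ.2])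
  have h1 := abs_quarterCos_sub_le N hδ ht
  have h2 := abs_quarterSin_sub_le N hδ hδ1 ht
  rw [hs, ha] at h2
  rw [ha] at h1
  have h3 : (1 - δ) ^ (2 * N) ≤ (1 - δ) ^ (2 * N) / δ := by
    rw [le_div_iff₀ hδ]
    exact mul_le_of_le_one_right (pow_nonneg (by linarith) _) hδ1
  rw [Complex.exp_mul_I, ← Complex.ofReal_cos, ← Complex.ofReal_sin]
  calc _ = ‖((quarterCos N (-Real.cos θ) - Real.cos ((θ - Real.pi / 2) / 4) : ℝ) : ℂ)
        + ((Real.sin θ * quarterSin N (-Real.cos θ) - Real.sin ((θ - Real.pi / 2) / 4) : ℝ) : ℂ)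
          * Complex.I‖ := by
        congr 1
        push_cast
        ring
    _ ≤ _ := by
        refine (norm_add_le _ _).trans ?_
        rw [norm_mul, Complex.norm_I, mul_one, Complex.norm_real, Complex.norm_real,
          Real.norm_eq_abs, Real.norm_eq_abs]
        linarith

/-- A circuit for the fourth root of the oracle `e^{iθσ_x}` away from the endpoints. -/
theorem exists_circuit_quarter (N : ℕ) {δ κ : ℝ} (hδ : 0 < δ) (hδ1 : δ ≤ 1) (hκ : 0 < κ)
    (hκ1 : κ ≤ 1) :
    ∃ c : Circuit 1, c.length = 4 * N + 5 ∧ ∀ θ : ℝ, ∃ α β : ℂ,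
      Complex.normSq α + Complex.normSq β = 1 ∧ (c.eval fun _ => rotX θ) = su2 α β ∧
      (θ ∈ Set.Icc 0 Real.pi → |Real.cos θ| ≤ 1 - δ →
        ‖(⟨α.re, β.im⟩ : ℂ) - Complex.exp ((θ / 4 : ℝ) * Complex.I)‖
          ≤ κ + 2 * ((1 - δ) ^ (2 * (N + 1)) / δ)) := by
  -- This phase undoes the shift in arcsin(−cos θ) = θ − π/2 after division by 4.
  set ω := Complex.exp ((Real.pi / 8 : ℝ) * Complex.I) with hω
  have hω1 : ‖ω‖ = 1 := Complex.norm_exp_ofReal_mul_I _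
  -- The factor 1 − κ makes the bound on the circle strict, as the completion requires, at the price
  -- of an error κ.
  set p := C (((1 - κ : ℝ) : ℂ) * ω) * quarterPoly N with hp
  have hpdeg : p.natDegree ≤ 2 * (N + 1) :=
    (natDegree_C_mul_le _ _).trans (natDegree_quarterPoly_le N)
  have hnorm : ‖((1 - κ : ℝ) : ℂ)‖ = 1 - κ := by
    rw [Complex.norm_real, Real.norm_of_nonneg (by linarith)]
  have hplt : ∀ w : ℂ, ‖w‖ = 1 → ‖p.eval w‖ < 1 := fun w hw => by
    have h := norm_eval_quarterPoly_le_one N hw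
    rw [hp, eval_mul, eval_C, norm_mul, norm_mul, hω1, mul_one, hnorm]
    nlinarith
  obtain ⟨q, hq, hpq⟩ := exists_norm_sq_add_norm_sq_eq_one hpdeg hplt
  obtain ⟨c, hc, hce⟩ :=
    exists_circuit_of_norm_sq_add_norm_sq_eq_one _ p q hpdeg hq hpq
  refine ⟨c, by rw [hc]; ring, fun θ => ?_⟩
  obtain ⟨⟨α, β, hn, hαβ⟩, he⟩ := hce θ
  refine ⟨α, β, hn, hαβ, fun hθ hcos => ?_⟩
  set F : ℂ := quarterCos (N + 1) (-Real.cos θ)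
    + (Real.sin θ * quarterSin (N + 1) (-Real.cos θ) : ℝ) * Complex.I with hF
  have hz : Complex.exp (θ * Complex.I) ^ (2 * (N + 1)) ≠ 0 := pow_ne_zero _ (Complex.exp_ne_zero _)
  -- Half the sum of the two entries of a vector is its first σ_x-coordinate; for the image of (1,
  -- 1) it equals Re α + i Im β.
  have hαF : (⟨α.re, β.im⟩ : ℂ) = ((1 - κ : ℝ) : ℂ) * ω * F := by
    refine mul_left_cancel₀ hz ?_
    have h0 := congrFun he 0
    have h1 := congrFun he 1
    rw [hαβ] at h0 h1
    simp only [xVec, su2, Matrix.mulVec, dotProduct, Fin.sum_univ_two, Pi.smul_apply, smul_eq_mul,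
      Matrix.of_apply, Matrix.cons_val', Matrix.cons_val_zero, Matrix.cons_val_one,
      Matrix.cons_val_fin_one, add_zero, sub_zero, mul_one] at h0 h1
    have hsum : (α + β) + (-conj β + conj α) = 2 * (⟨α.re, β.im⟩ : ℂ) := by
      apply Complex.ext <;> simp <;> ring
    have hpe : p.eval (Complex.exp (θ * Complex.I) ^ 2)
        = ((1 - κ : ℝ) : ℂ) * ω * (Complex.exp (θ * Complex.I) ^ (2 * (N + 1)) * F) := by
      rw [hp, eval_mul, eval_C, eval_quarterPoly]
    linear_combination (h0 + h1) / 2 + hpe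
      - Complex.exp (θ * Complex.I) ^ (2 * (N + 1)) / 2 * hsum
  have hexp : Complex.exp ((θ / 4 : ℝ) * Complex.I)
      = ω * Complex.exp (((θ - Real.pi / 2) / 4 : ℝ) * Complex.I) := by
    rw [hω, ← Complex.exp_add]
    congr 1
    push_cast
    ring
  have herr := norm_quarter_sub_exp_le (N + 1) hδ hδ1 hθ hcos
  rw [← hF] at herr
  rw [hαF, hexp]
  set E := Complex.exp (((θ - Real.pi / 2) / 4 : ℝ) * Complex.I) with hE
  have hE1 : ‖E‖ = 1 := Complex.norm_exp_ofReal_mul_I _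
  have hdec : ((1 - κ : ℝ) : ℂ) * ω * F - ω * E
      = ω * (((1 - κ : ℝ) : ℂ) * (F - E) - (κ : ℂ) * E) := by
    push_cast
    ring
  rw [hdec, norm_mul, hω1, one_mul]
  refine (norm_sub_le _ _).trans ?_
  rw [norm_mul, norm_mul, hE1, hnorm, Complex.norm_real, Real.norm_of_nonneg hκ.le]
  nlinarith [norm_nonneg (F - E)]

end QGadget

/-! ### Error propagation, gadgets and costs -/

namespace QGadget

open ComplexConjugate

/-- If `(α, β)` has `σ_x`-component close to `e^{iθ/4}`, then the palindrome is close to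
`e^{iθσ_x/2}`. -/
theorem palindrome_error {α β : ℂ} {φ η : ℝ} (hn : Complex.normSq α + Complex.normSq β = 1)
    (h : ‖(⟨α.re, β.im⟩ : ℂ) - Complex.exp (φ * Complex.I)‖ ≤ η) :
    |Complex.normSq α - Complex.normSq β - Real.cos (2 * φ)| ≤ 6 * η ∧
      (2 * (α * β)).re ^ 2 ≤ 8 * η := by
  have hre := (Complex.abs_re_le_norm _).trans h
  have him := (Complex.abs_im_le_norm _).trans h
  rw [Complex.sub_re, Complex.exp_ofReal_mul_I_re] at hre
  rw [Complex.sub_im, Complex.exp_ofReal_mul_I_im] at him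
  have hF : 1 - η ≤ ‖(⟨α.re, β.im⟩ : ℂ)‖ := by
    have h1 := norm_sub_norm_le (Complex.exp (φ * Complex.I)) ⟨α.re, β.im⟩
    rw [Complex.norm_exp_ofReal_mul_I, norm_sub_rev] at h1
    linarith
  have hFsq : ‖(⟨α.re, β.im⟩ : ℂ)‖ ^ 2 = α.re ^ 2 + β.im ^ 2 := by
    rw [← Complex.normSq_eq_norm_sq, Complex.normSq_apply]
    ring
  simp only at hre him
  simp only [Complex.normSq_apply] at hn ⊢
  -- Normalization leaves for the other coordinate only 1 − (1−η)² of the weight.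
  have hrest : α.im ^ 2 + β.re ^ 2 ≤ 2 * η := by
    nlinarith [sq_nonneg (‖(⟨α.re, β.im⟩ : ℂ)‖ - 1)]
  have key : ∀ x y : ℝ, |x - y| ≤ η → |x| ≤ 1 → |y| ≤ 1 → |x ^ 2 - y ^ 2| ≤ 2 * η :=
    fun x y hxy hx hy => by
      rw [show x ^ 2 - y ^ 2 = (x + y) * (x - y) by ring, abs_mul]
      exact mul_le_mul ((abs_add_le x y).trans (by linarith)) hxy (abs_nonneg _) zero_le_two
  have ha : |α.re| ≤ 1 := (sq_le_one_iff_abs_le_one _).1 (by nlinarith)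
  have hb : |β.im| ≤ 1 := (sq_le_one_iff_abs_le_one _).1 (by nlinarith)
  have h1 := abs_le.1 (key _ _ hre ha (Real.abs_cos_le_one φ))
  have h2 := abs_le.1 (key _ _ him hb (Real.abs_sin_le_one φ))
  constructor
  · rw [Real.cos_two_mul']
    have := sq_nonneg α.im
    have := sq_nonneg β.re
    rw [abs_le]
    constructor <;> linarith
  · have e : (2 * (α * β)).re = 2 * (α.re * β.re - α.im * β.im) := by simp
    -- Cauchy–Schwarz, pairing the large coordinates with the small ones.
    have h3 : (α.re * β.re - α.im * β.im) ^ 2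
        ≤ (α.re ^ 2 + β.im ^ 2) * (α.im ^ 2 + β.re ^ 2) := by
      nlinarith [sq_nonneg (α.re * α.im + β.re * β.im)]
    have h4 : (α.re ^ 2 + β.im ^ 2) * (α.im ^ 2 + β.re ^ 2) ≤ 1 * (α.im ^ 2 + β.re ^ 2) := by
      refine mul_le_mul_of_nonneg_right ?_ (by positivity)
      nlinarith [sq_nonneg α.im, sq_nonneg β.re]
    rw [e, mul_pow]
    linarith

theorem normSq_sub_sq_add_normSq_two_mul {α β : ℂ}
    (hn : Complex.normSq α + Complex.normSq β = 1) :
    (Complex.normSq α - Complex.normSq β) ^ 2 + Complex.normSq (2 * (α * β)) = 1 := by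
  rw [Complex.normSq_mul, Complex.normSq_mul, Complex.normSq_ofNat]
  linear_combination (Complex.normSq α + Complex.normSq β + 1) * hn

/-- `eval_linkProduct` says nothing about the size of its off-diagonal entry; membership in SU(2)
supplies the normalization. -/
theorem IsSU2.isTwistedEmbeddable {M : Op} {r : ℝ} {β : ℂ} (h : IsSU2 M) (e : M = su2 r β) :
    IsTwistedEmbeddable M := by
  obtain ⟨a, b, hab, rfl⟩ := h
  have h0 : a = r := congrFun (congrFun e 0) 0
  have h1 : b = β := congrFun (congrFun e 0) 1
  subst h0 h1
  refine isTwistedEmbeddable_su2 ?_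
  rwa [Complex.normSq_ofReal, ← sq] at hab

theorem isSU2_rotZ (φ : ℝ) : IsSU2 (rotZ φ) := by
  refine ⟨Complex.exp (Complex.I * φ), 0, ?_, ?_⟩
  · rw [Complex.normSq_eq_norm_sq, mul_comm, Complex.norm_exp_ofReal_mul_I]
    simp
  · simp [rotZ, su2, ← Complex.exp_conj]

/-- The product circuit preserves `SU(2)`. -/
theorem isSU2_eval_linkProduct {c : Circuit 1} {U : Fin 2 → Op} (h : IsSU2 (c.eval fun _ => U 0))
    (hU : IsSU2 (U 1)) : IsSU2 ((linkProduct c).eval U) := by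
  have h' : IsSU2 ((c.subst fun _ => [Gate.query 0]).eval U) := by
    rw [Circuit.eval_subst]
    simpa [Circuit.eval, Gate.eval] using h
  have h1 : IsSU2 (Circuit.eval [Gate.query 1] U) := by simpa [Circuit.eval, Gate.eval] using hU
  rw [linkProduct, Circuit.eval_subst, productCircuit_eq]
  simp only [Circuit.eval_cons, Gate.eval, Matrix.cons_val_zero, Matrix.cons_val_one]
  have hz := isSU2_rotZ
  have he : Circuit.eval [] (fun j => Circuit.eval
      ((![c.subst fun _ => [.query 0], [.query 1]] : Fin 2 → Circuit 2) j) U) = 1 := rfl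
  rw [he, mul_one]
  exact (hz _).mul (h'.mul ((hz _).mul (h1.mul ((hz _).mul (h'.mul (hz _))))))

/-- The gadget of a palindromic circuit. -/
noncomputable def palindromeGadget (c : Circuit 1) (hc : ∀ θ, IsSU2 (c.eval fun _ => rotX θ)) :
    Gadget 1 1 where
  circuit _ := c.palindrome
  twisted U hU _ := by
    obtain ⟨θ, _, hθ⟩ := hU 0
    obtain ⟨α, β, hn, he⟩ := hc θ
    have hU' : U = fun _ => rotX θ := funext fun j => by rw [Subsingleton.elim j 0, hθ]
    rw [hU', c.eval_palindrome (fun _ => θ) he]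
    exact isTwistedEmbeddable_su2 (normSq_sub_sq_add_normSq_two_mul hn)

/-- The gadget obtained by substituting a palindromic circuit into the product circuit. -/
noncomputable def productGadget (c : Circuit 1) (hc : ∀ θ, IsSU2 (c.eval fun _ => rotX θ)) :
    Gadget 2 1 where
  circuit _ := linkProduct c.palindrome
  twisted U hU _ := by
    obtain ⟨θ, _, hθ⟩ := hU 0
    obtain ⟨θ₁, _, hθ₁⟩ := hU 1
    obtain ⟨α, β, hn, he⟩ := hc θ
    have hn' := normSq_sub_sq_add_normSq_two_mul hn
    have hp : (c.palindrome.eval fun _ => U 0)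
        = su2 ((Complex.normSq α - Complex.normSq β : ℝ) : ℂ) (2 * (α * β)) := by
      rw [hθ]
      exact c.eval_palindrome (fun _ => θ) he
    obtain ⟨β', hβ'⟩ := eval_linkProduct c.palindrome θ₁ _ _ U hp hθ₁ hn'
    refine IsSU2.isTwistedEmbeddable (isSU2_eval_linkProduct ⟨_, _, ?_, hp⟩ ?_) hβ'
    · rw [Complex.normSq_ofReal, ← sq, hn']
    · rw [hθ₁]
      exact isSU2_rotX θ₁

theorem depth_productGadget (c : Circuit 1) (hc : ∀ θ, IsSU2 (c.eval fun _ => rotX θ)) :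
    (productGadget c hc).depth = 4 * c.length + 5 := by
  have h : (productGadget c hc).depth = (linkProduct c.palindrome).length := by
    simp [Gadget.depth, productGadget, Circuit.depth]
  rw [h, length_linkProduct, Circuit.length_palindrome]
  ring

theorem Gadget.cost_le_mul_depth (G : Gadget 2 1) : G.cost ≤ 2 * G.depth := by
  have h : ∀ j, (G.circuit 0).queries j ≤ G.depth := fun j =>
    List.countP_le_length.trans (Finset.le_sup (f := fun k => (G.circuit k).depth)
      (Finset.mem_univ 0))
  have e : G.cost = (G.circuit 0).queries 0 + (G.circuit 0).queries 1 := by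
    simp [Gadget.cost, Gadget.costMatrix, Fin.sum_univ_two]
  have := h 0
  have := h 1
  omega

theorem cos_two_mul_arccos_div_four {x : ℝ} (h1 : -1 ≤ x) (h2 : x ≤ 1) :
    Real.cos (2 * (Real.arccos x / 4)) = √((1 + x) / 2) := by
  rw [show 2 * (Real.arccos x / 4) = Real.arccos x / 2 by ring,
    Real.cos_half (by linarith [Real.arccos_nonneg x, Real.pi_pos]) (Real.arccos_le_pi x),
    Real.cos_arccos h1 h2]

/-- Exponential decay with the chosen number of terms. -/
theorem one_sub_pow_div_le {δ ε : ℝ} {N : ℕ} (hδ : 0 < δ) (hδ1 : δ ≤ 1) (hε : 0 < ε)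
    (hε2 : ε ≤ 1 / 2)
    (hN : 4 * (δ⁻¹ * Real.log (ε ^ (-2 : ℝ) * δ ^ (-(1 / 4) : ℝ))) ≤ N) :
    (1 - δ) ^ (2 * N) / δ ≤ ε ^ 2 / 4096 := by
  set L := Real.log (ε ^ (-2 : ℝ) * δ ^ (-(1 / 4) : ℝ)) with hL
  have hLe : L = -2 * Real.log ε + -(1 / 4) * Real.log δ := by
    rw [hL, Real.log_mul (Real.rpow_pos_of_pos hε _).ne' (Real.rpow_pos_of_pos hδ _).ne',
      Real.log_rpow hε, Real.log_rpow hδ]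
  have h1 : (1 - δ) ^ (2 * N) ≤ Real.exp (-(8 * L)) := by
    have h2 : 1 - δ ≤ Real.exp (-δ) := by linarith [Real.add_one_le_exp (-δ)]
    refine (pow_le_pow_left₀ (by linarith) h2 _).trans ?_
    rw [← Real.exp_nat_mul, Real.exp_le_exp]
    have h3 := mul_le_mul_of_nonneg_left hN hδ.le
    rw [mul_left_comm, mul_inv_cancel_left₀ hδ.ne'] at h3
    push_cast
    linarith
  -- One δ pays for the division by δ, and ε^14 ≤ 2^(−14) for the constant 1/4096.
  have h4 : Real.exp (-(8 * L)) = ε ^ 16 * δ ^ 2 := by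
    rw [hLe, ← Real.exp_log (pow_pos hε 16), ← Real.exp_log (pow_pos hδ 2), ← Real.exp_add,
      Real.log_pow, Real.log_pow]
    congr 1
    push_cast
    ring
  rw [h4] at h1
  have h5 : ε ^ 14 ≤ (1 / 2) ^ 14 := pow_le_pow_left₀ hε.le hε2 14
  rw [div_le_iff₀ hδ]
  calc (1 - δ) ^ (2 * N) ≤ ε ^ 14 * ε ^ 2 * δ * δ := h1.trans_eq (by ring)
    _ ≤ (1 / 2) ^ 14 * ε ^ 2 * δ * 1 := by gcongr
    _ ≤ ε ^ 2 / 4096 * δ := by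
      have : 0 ≤ ε ^ 2 * δ := by positivity
      linarith

theorem one_le_log_rpow_mul_rpow {δ ε : ℝ} (hδ : 0 < δ) (hδ1 : δ ≤ 1) (hε : 0 < ε)
    (hε2 : ε ≤ 1 / 2) : 1 ≤ Real.log (ε ^ (-2 : ℝ) * δ ^ (-(1 / 4) : ℝ)) := by
  rw [Real.log_mul (Real.rpow_pos_of_pos hε _).ne' (Real.rpow_pos_of_pos hδ _).ne',
    Real.log_rpow hε, Real.log_rpow hδ]
  have h1 := Real.log_nonpos hδ.le hδ1
  have h2 := Real.log_le_log hε hε2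
  rw [one_div, Real.log_inv] at h2
  have h3 := Real.log_two_gt_d9
  linarith

/-- The error splits into 2(r² − s²)y, at most ε/8, and the cross term 2rtb, at most ε/2. -/
theorem product_error {r s x y b t ε : ℝ} (hr : |r| ≤ 1) (hs : |s| ≤ 1) (hx : x = 2 * s ^ 2 - 1)
    (hrs : |r - s| ≤ ε / 32) (hb : |b| ≤ ε / 4) (hy : |y| ≤ 1) (ht : |t| ≤ 1) :
    |(2 * r ^ 2 - 1) * y + 2 * r * t * b - x * y| ≤ ε := by
  have e : (2 * r ^ 2 - 1) * y + 2 * r * t * b - x * y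
      = 2 * ((r + s) * (r - s)) * y + 2 * (r * t) * b := by
    rw [hx]
    ring
  have h1 : |2 * ((r + s) * (r - s)) * y| ≤ 2 * (2 * (ε / 32)) * 1 := by
    rw [abs_mul, abs_mul, abs_mul, abs_two]
    have : |r + s| ≤ 2 := (abs_add_le r s).trans (by linarith)
    have := abs_nonneg (r - s)
    gcongr
    linarith
  have h2 : |2 * (r * t) * b| ≤ 2 * (1 * 1) * (ε / 4) := by
    rw [abs_mul, abs_mul, abs_mul, abs_two]
    gcongr
  have h3 := abs_nonneg (r - s)
  rw [e]
  exact (abs_add_le _ _).trans (by linarith)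

end QGadget

/-! ### Choice of constants and assembly -/

theorem mainTheorem6 :
    ∃ C : ℝ, 0 < C ∧ ∀ δ ε : ℝ, 0 < δ → δ ≤ 1 → 0 < ε → ε ≤ 1 / 2 →
      ∃ (R : QGadget.Gadget 1 1) (G : QGadget.Gadget 2 1),
        R.ApproxAchieves ε (fun _ x => Real.sqrt ((1 + x 0) / 2))
          {x | x 0 ∈ Set.Icc (-1 + δ) (1 - δ)} ∧
        G.circuit 0 = QGadget.linkProduct (R.circuit 0) ∧
        G.ApproxAchieves ε (fun _ x => x 0 * x 1)
          {x | x 0 ∈ Set.Icc (-1 + δ) (1 - δ) ∧ x 1 ∈ Set.Icc (-1 : ℝ) 1} ∧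
        (G.cost : ℝ) ≤ C * (δ⁻¹ * Real.log (ε ^ (-2 : ℝ) * δ ^ (-(1 / 4) : ℝ))) ∧
        (G.depth : ℝ) ≤ C * (δ⁻¹ * Real.log (ε ^ (-2 : ℝ) * δ ^ (-(1 / 4) : ℝ))) := by
  -- The depth is 4(4N+5)+5 = 16N+25 with N < 4δ⁻¹L + 1, hence below 150 δ⁻¹L as δ⁻¹L ≥ 1; the cost
  -- is at most twice the depth.
  refine ⟨300, by norm_num, fun δ ε hδ hδ1 hε hε2 => ?_⟩
  have hlog := QGadget.one_le_log_rpow_mul_rpow hδ hδ1 hε hε2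
  set L := Real.log (ε ^ (-2 : ℝ) * δ ^ (-(1 / 4) : ℝ)) with hL
  have hL1 : 1 ≤ δ⁻¹ * L := one_le_mul_of_one_le_of_one_le ((one_le_inv₀ hδ).2 hδ1) hlog
  set N := ⌈4 * (δ⁻¹ * L)⌉₊ with hN
  have hNle : 4 * (δ⁻¹ * L) ≤ (N + 1 : ℕ) := (Nat.le_ceil _).trans (by push_cast; linarith)
  have hNlt : (N : ℝ) < 4 * (δ⁻¹ * L) + 1 := Nat.ceil_lt_add_one (by linarith)
  have hpow := QGadget.one_sub_pow_div_le hδ hδ1 hε hε2 hNle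
  -- This κ and twice the truncation bound ε²/4096 add up to η = ε²/1024, for which 6η ≤ ε/32 and 8η
  -- ≤ (ε/4)².
  obtain ⟨c, hlen, hc⟩ := QGadget.exists_circuit_quarter N (κ := ε ^ 2 / 2048) hδ hδ1
    (by positivity) (by nlinarith)
  have hsu : ∀ θ, QGadget.IsSU2 (c.eval fun _ => QGadget.rotX θ) := fun θ => by
    obtain ⟨α, β, hn, he, _⟩ := hc θ
    exact ⟨α, β, hn, he⟩
  have main : ∀ x : ℝ, x ∈ Set.Icc (-1 + δ) (1 - δ) → ∃ (r : ℝ) (β : ℂ),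
      (c.palindrome.eval fun _ => QGadget.rotX (Real.arccos x)) = QGadget.su2 r β ∧
      r ^ 2 + Complex.normSq β = 1 ∧ |r - √((1 + x) / 2)| ≤ ε / 32 ∧ |β.re| ≤ ε / 4 := by
    intro x hx
    have hx1 : -1 ≤ x := by linarith [hx.1]
    have hx2 : x ≤ 1 := by linarith [hx.2]
    obtain ⟨α, β, hn, he, herr⟩ := hc (Real.arccos x)
    have h := herr ⟨Real.arccos_nonneg x, Real.arccos_le_pi x⟩ (by
      rw [Real.cos_arccos hx1 hx2, abs_le]
      constructor <;> linarith [hx.1, hx.2])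
    obtain ⟨h1, h2⟩ := QGadget.palindrome_error (η := ε ^ 2 / 1024) hn (h.trans (by linarith))
    rw [QGadget.cos_two_mul_arccos_div_four hx1 hx2] at h1
    refine ⟨_, _, c.eval_palindrome (fun _ => Real.arccos x) he,
      QGadget.normSq_sub_sq_add_normSq_two_mul hn, h1.trans (by nlinarith), ?_⟩
    exact abs_le_of_sq_le_sq (by nlinarith) (by positivity)
  have hdepth : ((QGadget.productGadget c hsu).depth : ℝ) ≤ 150 * (δ⁻¹ * L) := by
    rw [QGadget.depth_productGadget, hlen]
    push_cast
    linarith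
  refine ⟨QGadget.palindromeGadget c hsu, QGadget.productGadget c hsu, ?_, rfl, ?_, ?_, ?_⟩
  · intro x hx k
    obtain ⟨r, β, he, -, h1, -⟩ := main (x 0) hx
    have hU : (fun j => QGadget.rotX (Real.arccos (x j)))
        = fun _ => QGadget.rotX (Real.arccos (x 0)) :=
      funext fun j => by rw [Subsingleton.elim j 0]
    have ha : (QGadget.palindromeGadget c hsu).achieved k x = r := by
      rw [QGadget.Gadget.achieved, hU]
      exact congrFun (congrFun he 0) 0
    rw [ha, ← Complex.ofReal_sub, Complex.norm_real, Real.norm_eq_abs]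
    linarith
  · rintro x ⟨hx, hy⟩ k
    obtain ⟨r, β, he, hn, h1, h2⟩ := main (x 0) hx
    obtain ⟨β', hβ'⟩ := QGadget.eval_linkProduct c.palindrome (Real.arccos (x 1)) r β
      (fun j => QGadget.rotX (Real.arccos (x j))) he rfl hn
    rw [Real.cos_arccos hy.1 hy.2] at hβ'
    have ha : (QGadget.productGadget c hsu).achieved k x
        = (((2 * r ^ 2 - 1) * x 1 + 2 * r * Real.sin (Real.arccos (x 1)) * β.re : ℝ) : ℂ) :=
      congrFun (congrFun hβ' 0) 0
    rw [ha, ← Complex.ofReal_sub, Complex.norm_real, Real.norm_eq_abs]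
    have hx0 : 0 ≤ (1 + x 0) / 2 := by linarith [hx.1]
    refine QGadget.product_error (s := √((1 + x 0) / 2)) ?_ ?_ ?_ h1 h2 (abs_le.2 hy)
      (Real.abs_sin_le_one _)
    · exact (sq_le_one_iff_abs_le_one _).1 (by linarith [Complex.normSq_nonneg β])
    · rw [abs_of_nonneg (Real.sqrt_nonneg _), Real.sqrt_le_one]
      linarith [hx.2]
    · rw [Real.sq_sqrt hx0]
      ring
  · have h := (QGadget.productGadget c hsu).cost_le_mul_depth
    have h' : ((QGadget.productGadget c hsu).cost : ℝ)
        ≤ 2 * ((QGadget.productGadget c hsu).depth : ℝ) := by exact_mod_cast h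
    linarith
  · linarith
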